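/- Let $d\ge 1$, $N\in\mathbb N$, and let $U$ be a unitary $d\times d$ matrix. For a unitary $W$ on $\mathbb C^n$ let $\mathcal P_W(X)=\sum_i\langle i|W^\dagger XW|i\rangle\,|i\rangle\langle i|$ be the von Neumann measurement in the basis $W|i\rangle$, viewed as a channel with classical output. For two channels $\Phi_1,\Phi_2$ with the same input space and the same output space, an unambiguous discrimination strategy is an input state $\sigma$ together with a three-outcome POVM $(M_1,M_2,M_?)$ on the output space such that $\operatorname{tr}(M_2\Phi_1(\sigma))=\operatorname{tr}(M_1\Phi_2(\sigma))=0$. Its success probability is $\frac12\big(\operatorname{tr}(M_1\Phi_1(\sigma))+\operatorname{tr}(M_2\Phi_2(\sigma))\big)$. An adaptive scheme with $N$ queries consists of an ancilla $\mathbb C^{a}$ of arbitrary dimension and unitaries $V^{(k)}_{i_1,\dots,i_k}$ ($1\le k\le N$, $i_1,\dots,i_k\in\{1,\dots,d\}$) acting on the query registers $k+1,\dots,N$ and the ancilla. It turns the black box $\mathcal P\in\{\mathcal P_{\mathbb 1},\mathcal P_U\}$ into a channel $\Psi$ on $(\mathbb C^d)^{\otimes N}\otimes\mathbb C^a$ as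 follows: for $k=1,\dots,N$ in this order, apply $\mathcal P$ to register $k$ and then the conditional unitary $\sum_{i_1,\dots,i_k}|i_1,\dots,i_k\rangle\langle i_1,\dots,i_k|\otimes V^{(k)}_{i_1,\dots,i_k}$. Denote the resulting channels by $\Psi_{\mathbb 1}$ and $\Psi_U$. The parallel scheme uses, instead, the channels $\mathcal P_{\mathbb 1^{\otimes N}}\otimes\mathrm{id}$ and $\mathcal P_{U^{\otimes N}}\otimes\mathrm{id}$ on $(\mathbb C^d)^{\otimes N}\otimes\mathbb C^a$, with $a$ arbitrary. Then the minimum $$m=\min_\rho\sum_i\big|\langle i|\rho\,U^{\otimes N}|i\rangle\big|$$ over all states $\rho$ on $(\mathbb C^d)^{\otimes N}$ exists ($i$ runs over the product basis), and every unambiguous strategy discriminating $\Psi_{\mathbb 1}$ from $\Psi_U$, in every adaptive scheme with $N$ queries, has success probability at most $1-m$. This value is attained by the parallel scheme: the maximal success probability of unambiguous discrimination in the parallel scheme, over all ancilla dimensions $a$, input states and POVMs, is exactly $1-m$, and so is the maximal success probability over all adaptive schemes. -/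

import Mathlib

namespace VNDisc

open Matrix
open scoped ComplexOrder

/-- `ρ` is a quantum state (density matrix). -/
def IsState {n : Type*} [Fintype n] (ρ : Matrix n n ℂ) : Prop :=
  ρ.PosSemidef ∧ ρ.trace = 1

/-- The operator `|i⟩⟨ψ_i|`, where `|ψ_i⟩ = W|i⟩` is the `i`-th column of `W`. -/
noncomputable def readout {n : Type*} [DecidableEq n] (W : Matrix n n ℂ) (i : n) :
    Matrix n n ℂ :=
  Matrix.vecMulVec (Pi.single i 1) (star (W.col i))

/-- The channel `P_W ⊗ id` on a system with basis `n` and an ancilla with basis `a`, where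
`P_W(X) = ∑ i, ⟨ψ_i|X|ψ_i⟩ |i⟩⟨i|` is the von Neumann measurement in the basis `|ψ_i⟩ = W|i⟩`
(for unitary `W`), seen as a channel with a classical output register. -/
noncomputable def measure {n : Type*} [Fintype n] [DecidableEq n] (a : Type*) [Fintype a]
    [DecidableEq a] (W : Matrix n n ℂ) (X : Matrix (n × a) (n × a) ℂ) :
    Matrix (n × a) (n × a) ℂ :=
  ∑ i, Matrix.kroneckerMap (· * ·) (readout W i) (1 : Matrix a a ℂ) * X *
    (Matrix.kroneckerMap (· * ·) (readout W i) (1 : Matrix a a ℂ))ᴴ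

/-- The tensor power `U^{⊗N}`, acting on `(ℂ^d)^{⊗N}` with its product basis. -/
def tensorPower {d : ℕ} (N : ℕ) (U : Matrix (Fin d) (Fin d) ℂ) :
    Matrix (Fin N → Fin d) (Fin N → Fin d) ℂ :=
  fun x y => ∏ k, U (x k) (y k)

/-- The product basis of `(ℂ^d)^{⊗N} ⊗ ℂ^a`: `N` query registers and an ancilla. -/
abbrev Idx (d N a : ℕ) : Type := (Fin N → Fin d) × Fin a

/-- The operator `A` acting on the `k`-th query register, tensored with the identity on all
other query registers and on the ancilla. -/
def onRegister {d N a : ℕ} (k : Fin N) (A : Matrix (Fin d) (Fin d) ℂ) :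
    Matrix (Idx d N a) (Idx d N a) ℂ :=
  fun p q => if (∀ j, j ≠ k → p.1 j = q.1 j) ∧ p.2 = q.2 then A (p.1 k) (q.1 k) else 0

/-- One query: the measurement `P_U` applied to the `k`-th query register; the classical label
is stored in that register. -/
noncomputable def query {d N a : ℕ} (U : Matrix (Fin d) (Fin d) ℂ) (k : Fin N)
    (X : Matrix (Idx d N a) (Idx d N a) ℂ) : Matrix (Idx d N a) (Idx d N a) ℂ :=
  ∑ i, onRegister k (readout U i) * X * (onRegister k (readout U i))ᴴ

/-- The product basis of what is left after the query of register `k`: the query registers after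
`k`, and the ancilla. -/
abbrev Rest (d N a : ℕ) (k : Fin N) : Type := ({j : Fin N // k < j} → Fin d) × Fin a

/-- Adaptive processing: for every `k` and every tuple of labels `i_1, …, i_k` obtained in the
registers up to `k`, a unitary on the remaining query registers and the ancilla. -/
abbrev Processing (d N a : ℕ) : Type :=
  (k : Fin N) → ({j : Fin N // j ≤ k} → Fin d) → Matrix.unitaryGroup (Rest d N a k) ℂ

/-- The conditional unitary `∑ |i_1,…,i_k⟩⟨i_1,…,i_k| ⊗ V^{(k)}_{i_1,…,i_k}`. -/
def conditional {d N a : ℕ} (V : Processing d N a) (k : Fin N) :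
    Matrix (Idx d N a) (Idx d N a) ℂ :=
  fun p q =>
    if ∀ j, j ≤ k → p.1 j = q.1 j then
      (V k (fun j => p.1 j) : Matrix (Rest d N a k) (Rest d N a k) ℂ)
        (fun j => p.1 j, p.2) (fun j => q.1 j, q.2)
    else 0

/-- The adaptive scheme with `N` queries to the box `P_U`: for `k = 1, …, N` in this order, query
the box on the `k`-th register and then apply the `k`-th conditional unitary. -/
noncomputable def adaptive {d N a : ℕ} (V : Processing d N a) (U : Matrix (Fin d) (Fin d) ℂ)
    (σ : Matrix (Idx d N a) (Idx d N a) ℂ) : Matrix (Idx d N a) (Idx d N a) ℂ :=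
  (List.finRange N).foldl (fun X k => conditional V k * query U k X * (conditional V k)ᴴ) σ

/-- The success probabilities of all unambiguous discrimination strategies between the channels
`Φ₁` and `Φ₂` with equal prior probabilities: an input state `σ` and a measurement
`(M₁, M₂, M₀)`, where `M₀` is the inconclusive answer, which never identifies the channel
wrongly. -/
def unambiguousValues {n : Type*} [Fintype n] [DecidableEq n]
    (Φ₁ Φ₂ : Matrix n n ℂ → Matrix n n ℂ) : Set ℝ :=
  {p | ∃ σ M₁ M₂ M₀ : Matrix n n ℂ, IsState σ ∧
    M₁.PosSemidef ∧ M₂.PosSemidef ∧ M₀.PosSemidef ∧ M₁ + M₂ + M₀ = 1 ∧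
    (M₂ * Φ₁ σ).trace = 0 ∧ (M₁ * Φ₂ σ).trace = 0 ∧
    (p : ℂ) = 1 / 2 * ((M₁ * Φ₁ σ).trace + (M₂ * Φ₂ σ).trace)}

/-- Success probabilities of entanglement-assisted unambiguous discrimination between `P_1` and
`P_U` with `N` queries in an adaptive scheme, over all ancilla dimensions and processings. -/
def adaptiveValues {d : ℕ} (N : ℕ) (U : Matrix (Fin d) (Fin d) ℂ) : Set ℝ :=
  {p | ∃ (a : ℕ) (V : Processing d N a), p ∈ unambiguousValues (adaptive V 1) (adaptive V U)}

/-- Success probabilities of entanglement-assisted unambiguous discrimination between `P_1` and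
`P_U` with `N` parallel queries, that is, between `P_{1^{⊗N}}` and `P_{U^{⊗N}}`, over all ancilla
dimensions. -/
def parallelValues {d : ℕ} (N : ℕ) (U : Matrix (Fin d) (Fin d) ℂ) : Set ℝ :=
  {p | ∃ a : ℕ, p ∈ unambiguousValues
    (measure (Fin a) (tensorPower N (1 : Matrix (Fin d) (Fin d) ℂ)))
    (measure (Fin a) (tensorPower N U))}

end VNDisc

/-! Upper bound. Give both black boxes Kraus operators `A i`, `B i` and set `G = ∑ (B i)ᴴ * A i`.
Zero error forces `M₂ * A i * σ = 0` and `M₁ * B i * σ = 0`, so the inconclusive element carries the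
whole cross term `tr (σ G)`. Testing it on `(A i - B i) σ (A i - B i)ᴴ` bounds the failure
probability below by `Re tr (σ G)` (`CoherentPair.exists_le`). The labels are classical, so Kraus
operators of `P_1` may be multiplied by phases `e i`. Since later processing is only controlled by
earlier labels, `G` becomes a product of `N` unitaries, each unitarily conjugate to `W = U *
diagonal e` on one register. If `W` moves vectors by a real angle at most `α`, then `G` moves them
by at most `N * α`; hence success is at most `1 - cos (N α)` while `N α ≤ π`. The same angle bound
for `W^{⊗N}` bounds the minimized sum below by `cos (N α)`.

The best phases come from duality for a single copy. If `m₁ > 0` is the one-copy minimum,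
Hahn-Banach gives a diagonal contraction `E` with Hermitian part of `U * diagonal E` at least `m₁`.
Its entrywise phases do as well (`ReLowerBound.unitary_part`), so `α = arccos m₁`.

Achievability. For a state `ρ`, a purification and an optimal two-vector measurement for each label
give success `1 - ∑ |⟨i|ρ U^{⊗N}|i⟩|`, provided that each overlap is at most both label
probabilities. This proviso fails for general states. Equality in the duality makes an optimal
one-copy state live on the eigenspaces of `W` with phases `exp (± i α)`; its two components have the
same diagonal and the same label statistics under both measurements (`exists_phaseStates`). Mixtures
of tensor products of these components then keep the statistics fixed, and their overlaps are a
common factor times the label probabilities. The factor can be `cos (N α)` if `N α ≤ π / 2`, and `0`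
otherwise, so the lower and upper bounds meet. -/

namespace VNDisc

open Matrix
open scoped ComplexOrder Kronecker

set_option linter.unusedSectionVars false

/-! ### Positive semidefinite matrices and vanishing traces. -/

section PosSemidef

variable {n m : Type*} [Fintype n] [Fintype m]

open scoped MatrixOrder in
theorem exists_eq_conjTranspose_mul_self {A : Matrix n n ℂ} (hA : A.PosSemidef) :
    ∃ B : Matrix n n ℂ, A = Bᴴ * B := by
  classical
  exact CStarAlgebra.nonneg_iff_eq_star_mul_self.mp hA.nonneg

theorem trace_mul_nonneg {A B : Matrix n n ℂ} (hA : A.PosSemidef) (hB : B.PosSemidef) :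
    0 ≤ (A * B).trace := by
  obtain ⟨C, rfl⟩ := exists_eq_conjTranspose_mul_self hA
  rw [Matrix.mul_assoc, Matrix.trace_mul_comm]
  exact (hB.mul_mul_conjTranspose_same C).trace_nonneg

/-- Writing `M = Nᴴ * N` and `σ = Sᴴ * S`, the trace is the squared Hilbert-Schmidt norm of `N * A *
Sᴴ`. This turns an outcome of probability zero into an operator identity. -/
theorem mul_mul_eq_zero_of_trace {M : Matrix n n ℂ} {σ : Matrix m m ℂ} (hM : M.PosSemidef)
    (hσ : σ.PosSemidef) (A : Matrix n m ℂ) (h : (M * (A * σ * Aᴴ)).trace = 0) :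
    M * A * σ = 0 := by
  obtain ⟨N, rfl⟩ := exists_eq_conjTranspose_mul_self hM
  obtain ⟨S, rfl⟩ := exists_eq_conjTranspose_mul_self hσ
  have h1 : ((N * A * Sᴴ) * (N * A * Sᴴ)ᴴ).trace = 0 := by
    rw [← h, Matrix.mul_assoc Nᴴ, Matrix.trace_mul_comm Nᴴ]
    simp only [conjTranspose_mul, conjTranspose_conjTranspose, Matrix.mul_assoc]
  rw [trace_mul_conjTranspose_self_eq_zero_iff] at h1
  calc Nᴴ * N * A * (Sᴴ * S) = Nᴴ * (N * A * Sᴴ) * S := by simp only [Matrix.mul_assoc]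
    _ = 0 := by rw [h1]; simp

theorem mul_eq_zero_of_trace [DecidableEq n] {M σ : Matrix n n ℂ} (hM : M.PosSemidef)
    (hσ : σ.PosSemidef) (h : (M * σ).trace = 0) : M * σ = 0 := by
  simpa using mul_mul_eq_zero_of_trace hM hσ (1 : Matrix n n ℂ) (by simpa using h)

theorem re_diag_nonneg {A : Matrix n n ℂ} (hA : A.PosSemidef) (i : n) : 0 ≤ (A i i).re :=
  (Complex.nonneg_iff.mp hA.diag_nonneg).1

theorem re_conj_diag_nonneg {A : Matrix n n ℂ} (hA : A.PosSemidef) (B : Matrix n n ℂ) (i : n) :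
    0 ≤ ((Bᴴ * A * B) i i).re :=
  re_diag_nonneg (hA.conjTranspose_mul_mul_same B) i

theorem posSemidef_of_re_nonneg {A : Matrix n n ℂ} (hA : A.IsHermitian)
    (h : ∀ x, 0 ≤ (star x ⬝ᵥ A *ᵥ x).re) : A.PosSemidef :=
  .of_dotProduct_mulVec_nonneg hA fun x =>
    Complex.nonneg_iff.mpr ⟨h x, (hA.im_star_dotProduct_mulVec_self x).symm⟩

end PosSemidef

/-! ### Hermitian parts of unitaries and real angles. -/

section ReLowerBound

variable {n : Type*} [Fintype n] [DecidableEq n]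

/-- The Hermitian part of `W` is at least `c`. -/
def ReLowerBound (c : ℝ) (W : Matrix n n ℂ) : Prop :=
  (W + Wᴴ - ((2 * c : ℝ) : ℂ) • (1 : Matrix n n ℂ)).PosSemidef

theorem isHermitian_re_sub (c : ℝ) (W : Matrix n n ℂ) :
    (W + Wᴴ - ((2 * c : ℝ) : ℂ) • (1 : Matrix n n ℂ)).IsHermitian := by
  simp [IsHermitian, conjTranspose_sub, conjTranspose_add, conjTranspose_smul, add_comm]

theorem star_dotProduct_conjTranspose_mulVec (W : Matrix n n ℂ) (x : n → ℂ) :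
    star x ⬝ᵥ Wᴴ *ᵥ x = star (star x ⬝ᵥ W *ᵥ x) := by
  rw [dotProduct_mulVec, ← star_mulVec, star_dotProduct]

theorem re_quadratic_sub (c : ℝ) (W : Matrix n n ℂ) (x : n → ℂ) :
    (star x ⬝ᵥ (W + Wᴴ - ((2 * c : ℝ) : ℂ) • (1 : Matrix n n ℂ)) *ᵥ x).re =
      2 * ((star x ⬝ᵥ W *ᵥ x).re - c * (star x ⬝ᵥ x).re) := by
  rw [sub_mulVec, add_mulVec, dotProduct_sub, dotProduct_add,
    star_dotProduct_conjTranspose_mulVec, smul_mulVec, one_mulVec, dotProduct_smul, smul_eq_mul]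
  simp
  ring

theorem reLowerBound_iff {c : ℝ} {W : Matrix n n ℂ} :
    ReLowerBound c W ↔ ∀ x, c * (star x ⬝ᵥ x).re ≤ (star x ⬝ᵥ W *ᵥ x).re := by
  constructor
  · intro h x
    have := (Complex.nonneg_iff.mp (h.dotProduct_mulVec_nonneg x)).1
    rw [re_quadratic_sub] at this
    linarith
  · intro h
    refine posSemidef_of_re_nonneg (isHermitian_re_sub c W) fun x => ?_
    rw [re_quadratic_sub]
    linarith [h x]

theorem ReLowerBound.conj {c : ℝ} {W V : Matrix n n ℂ} (h : ReLowerBound c W)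
    (hV : Vᴴ * V = 1) : ReLowerBound c (Vᴴ * W * V) := by
  have := Matrix.PosSemidef.conjTranspose_mul_mul_same h V
  unfold ReLowerBound
  convert this using 1
  simp only [Matrix.mul_sub, Matrix.mul_add, Matrix.sub_mul, Matrix.add_mul, Matrix.mul_smul,
    Matrix.smul_mul, Matrix.mul_one, hV, conjTranspose_mul, conjTranspose_conjTranspose,
    Matrix.mul_assoc]

theorem ReLowerBound.re_trace_le {c : ℝ} {W ρ : Matrix n n ℂ} (h : ReLowerBound c W)
    (hρ : IsState ρ) : c ≤ (ρ * W).trace.re := by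
  have h1 := (Complex.nonneg_iff.mp (trace_mul_nonneg hρ.1 h)).1
  have h2 : (ρ * Wᴴ).trace = star (ρ * W).trace := by
    rw [← trace_conjTranspose, conjTranspose_mul, hρ.1.isHermitian.eq, Matrix.trace_mul_comm]
  rw [Matrix.mul_sub, Matrix.mul_add, Matrix.mul_smul, Matrix.mul_one, trace_sub, trace_add,
    trace_smul, hρ.2, h2] at h1
  simp at h1
  linarith

theorem reLowerBound_neg_one {W : Matrix n n ℂ} (hW : Wᴴ * W = 1) : ReLowerBound (-1) W := by
  have := posSemidef_conjTranspose_mul_self (1 + W)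
  unfold ReLowerBound
  convert this using 1
  rw [conjTranspose_add, conjTranspose_one, Matrix.mul_add, Matrix.add_mul, Matrix.add_mul, hW]
  simp only [Matrix.one_mul, Matrix.mul_one]
  rw [show ((2 * (-1) : ℝ) : ℂ) = -2 by norm_num]
  module

theorem inner_toLp (x y : n → ℂ) :
    inner ℂ (WithLp.toLp 2 x) (WithLp.toLp 2 y) = star x ⬝ᵥ y := by
  rw [EuclideanSpace.inner_toLp_toLp, dotProduct_comm]

theorem real_inner_toLp (x y : n → ℂ) :
    inner ℝ (WithLp.toLp 2 x : EuclideanSpace ℂ n) (WithLp.toLp 2 y) = (star x ⬝ᵥ y).re := by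
  rw [← inner_toLp, PiLp.inner_apply, PiLp.inner_apply, Complex.re_sum]
  rfl

theorem norm_toLp_sq (x : n → ℂ) : ‖WithLp.toLp 2 x‖ ^ 2 = (star x ⬝ᵥ x).re := by
  rw [← inner_toLp, ← inner_self_eq_norm_sq (𝕜 := ℂ)]
  rfl

theorem norm_toLp_mulVec {W : Matrix n n ℂ} (hW : Wᴴ * W = 1) (x : n → ℂ) :
    ‖WithLp.toLp 2 (W *ᵥ x)‖ = ‖WithLp.toLp 2 x‖ := by
  rw [← sq_eq_sq₀ (norm_nonneg _) (norm_nonneg _), norm_toLp_sq, norm_toLp_sq, star_mulVec,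
    ← dotProduct_mulVec, mulVec_mulVec, hW, one_mulVec]

-- The real inner product is the real part of the complex one and `W` preserves norms, so the bound
-- on the quadratic form is a bound on the cosine of the real angle between `x` and `W x`.
open InnerProductGeometry in
theorem angle_mulVec_le {α : ℝ} (hα : 0 ≤ α) {W : Matrix n n ℂ}
    (hW : Wᴴ * W = 1) (h : ReLowerBound (Real.cos α) W) {x : n → ℂ} (hx : x ≠ 0) :
    angle (WithLp.toLp 2 x : EuclideanSpace ℂ n) (WithLp.toLp 2 (W *ᵥ x)) ≤ α := by
  have hx0 : 0 < ‖(WithLp.toLp 2 x : EuclideanSpace ℂ n)‖ := by simpa using hx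
  have h1 : Real.cos α ≤ Real.cos (angle (WithLp.toLp 2 x : EuclideanSpace ℂ n)
      (WithLp.toLp 2 (W *ᵥ x))) := by
    rw [cos_angle, norm_toLp_mulVec hW, le_div_iff₀ (by positivity), ← sq, norm_toLp_sq]
    have := reLowerBound_iff.mp h x
    rwa [← real_inner_toLp x (W *ᵥ x)] at this
  by_contra hlt
  push Not at hlt
  exact absurd h1 (not_le.mpr (Real.cos_lt_cos_of_nonneg_of_le_pi hα (angle_le_pi _ _) hlt))

/-- Triangle inequality for the phases of unitaries. -/
theorem ReLowerBound.mul {α β : ℝ} (hα : 0 ≤ α) (hβ : 0 ≤ β) (hαβ : α + β ≤ Real.pi)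
    {W X : Matrix n n ℂ} (hW : Wᴴ * W = 1) (hX : Xᴴ * X = 1)
    (hWα : ReLowerBound (Real.cos α) W) (hXβ : ReLowerBound (Real.cos β) X) :
    ReLowerBound (Real.cos (α + β)) (W * X) := by
  rw [reLowerBound_iff]
  intro x
  by_cases hx : x = 0
  · simp [hx]
  have hX0 : X *ᵥ x ≠ 0 := by
    intro h0
    apply hx
    have := congrArg (fun y => Xᴴ *ᵥ y) h0
    simpa [mulVec_mulVec, hX] using this
  have h1 := angle_mulVec_le hβ hX hXβ hx
  have h2 := angle_mulVec_le hα hW hWα hX0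
  -- Angles in the underlying real space form a metric on directions: go from `x` to `X x`, then to
  -- `W X x`.
  have h3 := InnerProductGeometry.angle_le_angle_add_angle
    (WithLp.toLp 2 x : EuclideanSpace ℂ n) (WithLp.toLp 2 (X *ᵥ x)) (WithLp.toLp 2 (W *ᵥ X *ᵥ x))
  have h4 := Real.cos_le_cos_of_nonneg_of_le_pi (InnerProductGeometry.angle_nonneg
    (WithLp.toLp 2 x : EuclideanSpace ℂ n) (WithLp.toLp 2 (W *ᵥ X *ᵥ x))) hαβ
    (by linarith)
  have hx0 : 0 < ‖(WithLp.toLp 2 x : EuclideanSpace ℂ n)‖ := by simpa using hx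
  rw [InnerProductGeometry.cos_angle, norm_toLp_mulVec hW, norm_toLp_mulVec hX,
    le_div_iff₀ (by positivity), ← sq, norm_toLp_sq] at h4
  rw [← mulVec_mulVec, ← real_inner_toLp x (W *ᵥ X *ᵥ x)]
  exact h4

end ReLowerBound

/-! ### Coherent overlap of two channels and the failure bound. -/

section CoherentPair

variable {n : Type*} [Fintype n] [DecidableEq n]

/-- `Φ₁` and `Φ₂` are channels that have Kraus operators `A i` and `B i` with
`∑ i, (B i)ᴴ * A i = G`. -/
def CoherentPair (Φ₁ Φ₂ : Matrix n n ℂ → Matrix n n ℂ) (G : Matrix n n ℂ) : Prop :=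
  ∃ (ι : Type) (_ : Fintype ι) (A B : ι → Matrix n n ℂ),
    (∀ X, Φ₁ X = ∑ i, A i * X * (A i)ᴴ) ∧ (∀ X, Φ₂ X = ∑ i, B i * X * (B i)ᴴ) ∧
    ∑ i, (A i)ᴴ * A i = 1 ∧ ∑ i, (B i)ᴴ * B i = 1 ∧ ∑ i, (B i)ᴴ * A i = G

theorem coherentPair_id : CoherentPair (fun X : Matrix n n ℂ => X) (fun X => X) 1 :=
  ⟨Unit, inferInstance, fun _ => 1, fun _ => 1, by simp, by simp, by simp, by simp, by simp⟩

/-- `Θ₁`, `Θ₂` act before `Φ₁`, `Φ₂`, so the new Kraus operators are the products `A i * S j` and `B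
i * T j`, and the old overlap is sandwiched. -/
theorem CoherentPair.comp {Φ₁ Φ₂ Θ₁ Θ₂ : Matrix n n ℂ → Matrix n n ℂ} {G H : Matrix n n ℂ}
    (h : CoherentPair Φ₁ Φ₂ G) {κ : Type} [Fintype κ] (S T : κ → Matrix n n ℂ)
    (hΘ₁ : ∀ X, Θ₁ X = ∑ j, S j * X * (S j)ᴴ) (hΘ₂ : ∀ X, Θ₂ X = ∑ j, T j * X * (T j)ᴴ)
    (hS : ∑ j, (S j)ᴴ * S j = 1) (hT : ∑ j, (T j)ᴴ * T j = 1)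
    (hH : ∑ j, (T j)ᴴ * G * S j = H) :
    CoherentPair (fun X => Φ₁ (Θ₁ X)) (fun X => Φ₂ (Θ₂ X)) H := by
  obtain ⟨ι, _, A, B, h₁, h₂, hA, hB, hG⟩ := h
  have key : ∀ (C D : ι → Matrix n n ℂ) (P Q : κ → Matrix n n ℂ),
      ∑ x : κ × ι, (C x.2 * P x.1)ᴴ * (D x.2 * Q x.1) =
        ∑ j, (P j)ᴴ * (∑ i, (C i)ᴴ * D i) * Q j := by
    intro C D P Q
    rw [Fintype.sum_prod_type]
    refine Finset.sum_congr rfl fun j _ => ?_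
    rw [Finset.mul_sum, Finset.sum_mul]
    simp only [conjTranspose_mul, Matrix.mul_assoc]
  have key' : ∀ (C : ι → Matrix n n ℂ) (P : κ → Matrix n n ℂ) (X : Matrix n n ℂ),
      ∑ i, C i * (∑ j, P j * X * (P j)ᴴ) * (C i)ᴴ =
        ∑ x : κ × ι, (C x.2 * P x.1) * X * (C x.2 * P x.1)ᴴ := by
    intro C P X
    rw [Fintype.sum_prod_type_right]
    refine Finset.sum_congr rfl fun i _ => ?_
    rw [Finset.mul_sum, Finset.sum_mul]
    simp only [conjTranspose_mul, Matrix.mul_assoc]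
  refine ⟨κ × ι, inferInstance, fun x => A x.2 * S x.1, fun x => B x.2 * T x.1, ?_, ?_, ?_, ?_, ?_⟩
  · intro X
    simp only [h₁, hΘ₁, key']
  · intro X
    simp only [h₂, hΘ₂, key']
  · rw [key, hA]
    simpa using hS
  · rw [key, hB]
    simpa using hT
  · rw [key, hG, hH]

theorem trace_kraus {ι : Type*} [Fintype ι] {A : ι → Matrix n n ℂ}
    (hA : ∑ i, (A i)ᴴ * A i = 1) (X : Matrix n n ℂ) :
    (∑ i, A i * X * (A i)ᴴ).trace = X.trace := by
  calc (∑ i, A i * X * (A i)ᴴ).trace = ((∑ i, (A i)ᴴ * A i) * X).trace := by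
        rw [trace_sum, Finset.sum_mul, trace_sum]
        exact Finset.sum_congr rfl fun i _ => by rw [Matrix.trace_mul_comm, Matrix.mul_assoc]
    _ = X.trace := by rw [hA, Matrix.one_mul]

theorem mul_kraus_mul_eq_zero {ι : Type*} [Fintype ι] {A : ι → Matrix n n ℂ} {M σ : Matrix n n ℂ}
    (hM : M.PosSemidef) (hσ : σ.PosSemidef) (h : (M * ∑ i, A i * σ * (A i)ᴴ).trace = 0) (i : ι) :
    M * A i * σ = 0 := by
  rw [Finset.mul_sum, trace_sum, Finset.sum_eq_zero_iff_of_nonneg fun i _ =>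
    trace_mul_nonneg hM (hσ.mul_mul_conjTranspose_same _)] at h
  exact mul_mul_eq_zero_of_trace hM hσ _ (h i (Finset.mem_univ i))

/-- The failure probability of an unambiguous strategy is at least the coherent overlap of the
channel outputs. -/
theorem CoherentPair.exists_le {Φ₁ Φ₂ : Matrix n n ℂ → Matrix n n ℂ} {G : Matrix n n ℂ}
    (h : CoherentPair Φ₁ Φ₂ G) {p : ℝ} (hp : p ∈ unambiguousValues Φ₁ Φ₂) :
    p ≤ 1 ∧ ∃ σ, IsState σ ∧ p ≤ 1 - (σ * G).trace.re := by
  obtain ⟨ι, _, A, B, h₁, h₂, hA, hB, hG⟩ := h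
  obtain ⟨σ, M₁, M₂, M₀, hσ, hM₁, hM₂, hM₀, hsum, h21, h12, hp⟩ := hp
  have t₁ : (Φ₁ σ).trace = 1 := by rw [h₁, trace_kraus hA, hσ.2]
  have t₂ : (Φ₂ σ).trace = 1 := by rw [h₂, trace_kraus hB, hσ.2]
  have e₁ : (M₁ * Φ₁ σ).trace = 1 - (M₀ * Φ₁ σ).trace := by
    have : (M₁ * Φ₁ σ).trace + (M₂ * Φ₁ σ).trace + (M₀ * Φ₁ σ).trace = 1 := by
      rw [← trace_add, ← trace_add, ← Matrix.add_mul, ← Matrix.add_mul, hsum, Matrix.one_mul, t₁]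
    linear_combination this - h21
  have e₂ : (M₂ * Φ₂ σ).trace = 1 - (M₀ * Φ₂ σ).trace := by
    have : (M₁ * Φ₂ σ).trace + (M₂ * Φ₂ σ).trace + (M₀ * Φ₂ σ).trace = 1 := by
      rw [← trace_add, ← trace_add, ← Matrix.add_mul, ← Matrix.add_mul, hsum, Matrix.one_mul, t₂]
    linear_combination this - h12
  have hpre : p = 1 - ((M₀ * Φ₁ σ).trace.re + (M₀ * Φ₂ σ).trace.re) / 2 := by
    have := congrArg Complex.re hp
    rw [e₁, e₂] at this
    simp at this
    linarith
  have hz₂ : ∀ i, M₂ * A i * σ = 0 := mul_kraus_mul_eq_zero hM₂ hσ.1 (by rw [← h₁, h21])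
  have hz₁ : ∀ i, M₁ * B i * σ = 0 := mul_kraus_mul_eq_zero hM₁ hσ.1 (by rw [← h₂, h12])
  -- Substitute `M₀ = 1 - M₁ - M₂`: unambiguity kills the `M₂` term from the left and the `M₁` term
  -- from the right.
  have cross : ∀ i, (M₀ * (A i * σ * (B i)ᴴ)).trace = (σ * ((B i)ᴴ * A i)).trace := by
    intro i
    have c₂ : M₂ * (A i * σ * (B i)ᴴ) = 0 := by
      rw [← Matrix.mul_assoc, ← Matrix.mul_assoc, hz₂, Matrix.zero_mul]
    have c₁ : A i * σ * (B i)ᴴ * M₁ = 0 := by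
      have := congrArg conjTranspose (hz₁ i)
      rw [conjTranspose_mul, conjTranspose_mul, hσ.1.isHermitian.eq, hM₁.isHermitian.eq,
        conjTranspose_zero] at this
      rw [Matrix.mul_assoc, Matrix.mul_assoc, this, Matrix.mul_zero]
    have hM₀' : M₀ = 1 - M₁ - M₂ := by rw [← hsum]; abel
    rw [hM₀', Matrix.sub_mul, c₂, sub_zero, Matrix.trace_mul_comm, Matrix.mul_sub, c₁, sub_zero,
      Matrix.mul_one, Matrix.mul_assoc, Matrix.trace_mul_comm, Matrix.mul_assoc]
  have cross' : ∀ i, (M₀ * (B i * σ * (A i)ᴴ)).trace = star (σ * ((B i)ᴴ * A i)).trace := by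
    intro i
    rw [← cross, ← trace_conjTranspose, conjTranspose_mul, conjTranspose_mul, conjTranspose_mul,
      conjTranspose_conjTranspose, hσ.1.isHermitian.eq, hM₀.isHermitian.eq, Matrix.trace_mul_comm]
    simp only [Matrix.mul_assoc]
  have n₁ : 0 ≤ (M₀ * Φ₁ σ).trace.re := by
    rw [h₁, Finset.mul_sum, trace_sum, Complex.re_sum]
    exact Finset.sum_nonneg fun i _ => (Complex.nonneg_iff.mp
      (trace_mul_nonneg hM₀ (hσ.1.mul_mul_conjTranspose_same _))).1
  have n₂ : 0 ≤ (M₀ * Φ₂ σ).trace.re := by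
    rw [h₂, Finset.mul_sum, trace_sum, Complex.re_sum]
    exact Finset.sum_nonneg fun i _ => (Complex.nonneg_iff.mp
      (trace_mul_nonneg hM₀ (hσ.1.mul_mul_conjTranspose_same _))).1
  refine ⟨by linarith, σ, hσ, ?_⟩
  -- Positivity of `M₀` on `(A i - B i) σ (A i - B i)ᴴ`; summing over `i` produces `G`.
  have main : ∀ i, 0 ≤ (M₀ * (A i * σ * (A i)ᴴ)).trace.re + (M₀ * (B i * σ * (B i)ᴴ)).trace.re -
      2 * (σ * ((B i)ᴴ * A i)).trace.re := by
    intro i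
    have := (Complex.nonneg_iff.mp
      (trace_mul_nonneg hM₀ (hσ.1.mul_mul_conjTranspose_same (A i - B i)))).1
    rw [conjTranspose_sub, Matrix.mul_sub, Matrix.sub_mul, Matrix.sub_mul, Matrix.sub_mul,
      Matrix.mul_sub, Matrix.mul_sub, Matrix.mul_sub, trace_sub, trace_sub, trace_sub, cross,
      cross'] at this
    simp at this
    linarith
  have := Finset.sum_nonneg fun i (_ : i ∈ Finset.univ) => main i
  rw [Finset.sum_sub_distrib, Finset.sum_add_distrib, ← Finset.mul_sum, ← Complex.re_sum,
    ← Complex.re_sum, ← Complex.re_sum, ← trace_sum, ← trace_sum, ← trace_sum, ← Finset.mul_sum,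
    ← Finset.mul_sum, ← Finset.mul_sum, ← h₁, ← h₂, hG] at this
  linarith

end CoherentPair

/-! ### Tensor products and operators on one register. -/

section TensorProd

variable {d N a : ℕ}

/-- The tensor product of a family of matrices. -/
def tensorProd (A : Fin N → Matrix (Fin d) (Fin d) ℂ) :
    Matrix (Fin N → Fin d) (Fin N → Fin d) ℂ :=
  fun x y => ∏ k, A k (x k) (y k)

theorem tensorPower_eq (U : Matrix (Fin d) (Fin d) ℂ) :
    tensorPower N U = tensorProd fun _ => U := rfl

theorem tensorProd_mul (A B : Fin N → Matrix (Fin d) (Fin d) ℂ) :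
    tensorProd A * tensorProd B = tensorProd (A * B) := by
  ext x y
  simp only [tensorProd, Matrix.mul_apply, Pi.mul_apply, ← Finset.prod_mul_distrib]
  rw [Finset.prod_univ_sum, Fintype.piFinset_univ]

theorem tensorProd_conjTranspose (A : Fin N → Matrix (Fin d) (Fin d) ℂ) :
    (tensorProd A)ᴴ = tensorProd fun k => (A k)ᴴ := by
  ext x y
  simp [tensorProd, conjTranspose_apply]

theorem tensorProd_one : tensorProd (1 : Fin N → Matrix (Fin d) (Fin d) ℂ) = 1 := by
  ext x y
  simp only [tensorProd, Pi.one_apply, Matrix.one_apply]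
  by_cases h : x = y
  · simp [h]
  · obtain ⟨k, hk⟩ := Function.ne_iff.mp h
    rw [if_neg h]
    exact Finset.prod_eq_zero (Finset.mem_univ k) (if_neg hk)

theorem tensorProd_trace (A : Fin N → Matrix (Fin d) (Fin d) ℂ) :
    (tensorProd A).trace = ∏ k, (A k).trace := by
  simp only [tensorProd, trace, diag_apply]
  rw [Finset.prod_univ_sum, Fintype.piFinset_univ]

theorem tensorProd_posSemidef {A : Fin N → Matrix (Fin d) (Fin d) ℂ}
    (hA : ∀ k, (A k).PosSemidef) : (tensorProd A).PosSemidef := by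
  choose B hB using fun k => exists_eq_conjTranspose_mul_self (hA k)
  have : tensorProd A = (tensorProd B)ᴴ * tensorProd B := by
    rw [tensorProd_conjTranspose, tensorProd_mul]
    exact congrArg _ (funext hB)
  rw [this]
  exact posSemidef_conjTranspose_mul_self _

theorem isState_tensorProd {A : Fin N → Matrix (Fin d) (Fin d) ℂ} (hA : ∀ k, IsState (A k)) :
    IsState (tensorProd A) :=
  ⟨tensorProd_posSemidef fun k => (hA k).1, by simp [tensorProd_trace, (hA _).2]⟩

theorem onRegister_eq (k : Fin N) (A : Matrix (Fin d) (Fin d) ℂ) :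
    (onRegister k A : Matrix (Idx d N a) (Idx d N a) ℂ) =
      tensorProd (Pi.mulSingle k A) ⊗ₖ (1 : Matrix (Fin a) (Fin a) ℂ) := by
  ext p q
  simp only [onRegister, kroneckerMap_apply, tensorProd, Matrix.one_apply]
  by_cases h2 : p.2 = q.2
  · by_cases h1 : ∀ j, j ≠ k → p.1 j = q.1 j
    · rw [if_pos ⟨h1, h2⟩, if_pos h2, mul_one, Finset.prod_eq_single k]
      · simp
      · intro j _ hj
        simp [Pi.mulSingle_eq_of_ne hj, h1 j hj]
      · simp
    · rw [if_neg fun h => h1 h.1]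
      push Not at h1
      obtain ⟨j, hj, hne⟩ := h1
      rw [Finset.prod_eq_zero (Finset.mem_univ j), zero_mul]
      simp [Pi.mulSingle_eq_of_ne hj, hne]
  · simp [h2]

theorem onRegister_mul (k : Fin N) (A B : Matrix (Fin d) (Fin d) ℂ) :
    (onRegister k A * onRegister k B : Matrix (Idx d N a) (Idx d N a) ℂ) =
      onRegister k (A * B) := by
  rw [onRegister_eq, onRegister_eq, onRegister_eq, ← mul_kronecker_mul, tensorProd_mul,
    ← Pi.mulSingle_mul, Matrix.one_mul]

theorem onRegister_one (k : Fin N) :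
    (onRegister k 1 : Matrix (Idx d N a) (Idx d N a) ℂ) = 1 := by
  rw [onRegister_eq, Pi.mulSingle_one, tensorProd_one, one_kronecker_one]

theorem onRegister_conjTranspose (k : Fin N) (A : Matrix (Fin d) (Fin d) ℂ) :
    (onRegister k A : Matrix (Idx d N a) (Idx d N a) ℂ)ᴴ = onRegister k Aᴴ := by
  ext p q
  simp only [onRegister, conjTranspose_apply, apply_ite star, star_zero]
  congr 1
  simp only [eq_comm]

theorem onRegister_sum {ι : Type*} (s : Finset ι) (k : Fin N)
    (A : ι → Matrix (Fin d) (Fin d) ℂ) :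
    (onRegister k (∑ i ∈ s, A i) : Matrix (Idx d N a) (Idx d N a) ℂ) =
      ∑ i ∈ s, onRegister k (A i) := by
  ext p q
  simp only [onRegister, Matrix.sum_apply]
  split_ifs <;> simp

theorem onRegister_smul (k : Fin N) (c : ℂ) (A : Matrix (Fin d) (Fin d) ℂ) :
    (onRegister k (c • A) : Matrix (Idx d N a) (Idx d N a) ℂ) = c • onRegister k A := by
  ext p q
  simp [onRegister]

theorem onRegister_add (k : Fin N) (A B : Matrix (Fin d) (Fin d) ℂ) :
    (onRegister k (A + B) : Matrix (Idx d N a) (Idx d N a) ℂ) =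
      onRegister k A + onRegister k B := by
  ext p q
  simp only [onRegister, Matrix.add_apply]
  split_ifs <;> simp

theorem onRegister_commute {k l : Fin N} (hkl : k ≠ l) (A B : Matrix (Fin d) (Fin d) ℂ) :
    Commute (onRegister k A : Matrix (Idx d N a) (Idx d N a) ℂ) (onRegister l B) := by
  unfold Commute SemiconjBy
  rw [onRegister_eq, onRegister_eq, ← mul_kronecker_mul, ← mul_kronecker_mul, tensorProd_mul,
    tensorProd_mul, Pi.mulSingle_commute hkl]

theorem onRegister_diagonal (k : Fin N) (D : Fin d → ℂ) :
    (onRegister k (diagonal D) : Matrix (Idx d N a) (Idx d N a) ℂ) =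
      diagonal fun p => D (p.1 k) := by
  ext p q
  simp only [onRegister, diagonal_apply]
  by_cases h : p = q
  · simp [h]
  · rw [if_neg h]
    split_ifs with h1 h2
    · exact absurd (Prod.ext (funext fun j => by
        by_cases hj : j = k
        · rw [hj, h2]
        · exact h1.1 j hj) h1.2) h
    · rfl
    · rfl

theorem onRegister_posSemidef (k : Fin N) {A : Matrix (Fin d) (Fin d) ℂ} (hA : A.PosSemidef) :
    (onRegister k A : Matrix (Idx d N a) (Idx d N a) ℂ).PosSemidef := by
  obtain ⟨B, rfl⟩ := exists_eq_conjTranspose_mul_self hA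
  rw [← onRegister_mul, ← onRegister_conjTranspose]
  exact posSemidef_conjTranspose_mul_self _

theorem ReLowerBound.onRegister {c : ℝ} {W : Matrix (Fin d) (Fin d) ℂ} (h : ReLowerBound c W)
    (k : Fin N) : ReLowerBound c (onRegister k W : Matrix (Idx d N a) (Idx d N a) ℂ) := by
  have := onRegister_posSemidef (a := a) k h
  rwa [sub_eq_add_neg, ← neg_smul, onRegister_add, onRegister_add, onRegister_smul, onRegister_one,
    ← onRegister_conjTranspose, neg_smul, ← sub_eq_add_neg] at this

theorem onRegister_isometry (k : Fin N) {W : Matrix (Fin d) (Fin d) ℂ} (h : Wᴴ * W = 1) :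
    (onRegister k W : Matrix (Idx d N a) (Idx d N a) ℂ)ᴴ * onRegister k W = 1 := by
  rw [onRegister_conjTranspose, onRegister_mul, h, onRegister_one]

theorem readout_eq {n : Type*} [Fintype n] [DecidableEq n] (W : Matrix n n ℂ) (i : n) :
    readout W i = diagonal (Pi.single i 1) * Wᴴ := by
  ext x y
  simp [readout, vecMulVec_apply, diagonal_mul, conjTranspose_apply, Pi.single_apply]
  split_ifs with h <;> simp [h]

theorem sum_diagonal_single {n : Type*} [Fintype n] [DecidableEq n] (e : n → ℂ) :
    ∑ i, e i • diagonal (Pi.single i (1 : ℂ)) = diagonal e := by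
  ext x y
  simp [Matrix.sum_apply, diagonal_apply, Pi.single_apply]

theorem diagonal_single_mul_self {n : Type*} [Fintype n] [DecidableEq n] (i : n) :
    diagonal (Pi.single i (1 : ℂ)) * diagonal (Pi.single i (1 : ℂ)) =
      diagonal (Pi.single i (1 : ℂ)) := by
  rw [diagonal_mul_diagonal]
  congr 1
  ext x
  by_cases h : x = i <;> simp [h]

theorem diagonal_single_conjTranspose {n : Type*} [Fintype n] [DecidableEq n] (i : n) :
    (diagonal (Pi.single i (1 : ℂ)))ᴴ = diagonal (Pi.single i (1 : ℂ)) := by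
  rw [diagonal_conjTranspose]
  congr 1
  ext x
  by_cases h : x = i <;> simp [h]

end TensorProd

theorem isometry_mul_diagonal {n : Type*} [Fintype n] [DecidableEq n] {U : Matrix n n ℂ}
    (hU : U * Uᴴ = 1) {e : n → ℂ} (he : ∀ i, ‖e i‖ = 1) :
    (U * diagonal e)ᴴ * (U * diagonal e) = 1 := by
  rw [conjTranspose_mul, Matrix.mul_assoc, ← Matrix.mul_assoc Uᴴ, mul_eq_one_comm.mp hU,
    Matrix.one_mul, diagonal_conjTranspose, diagonal_mul_diagonal, ← diagonal_one]
  congr 1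
  ext i
  rw [Pi.star_apply, mul_comm, Complex.star_def, Complex.mul_conj, Complex.normSq_eq_norm_sq, he i]
  simp

/-! ### The upper bound for adaptive schemes. -/

section Adaptive

variable {d N a : ℕ}

/-- Splitting the product basis into the registers up to `k` and the rest. -/
def splitEquiv (k : Fin N) : Idx d N a ≃ Rest d N a k × ({j : Fin N // j ≤ k} → Fin d) where
  toFun p := ((fun j => p.1 j, p.2), fun j => p.1 j)
  invFun q := (fun j => if h : j ≤ k then q.2 ⟨j, h⟩ else q.1.1 ⟨j, not_le.mp h⟩, q.1.2)
  left_inv p := by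
    refine Prod.ext (funext fun j => ?_) rfl
    by_cases h : j ≤ k <;> simp [h]
  right_inv q := by
    refine Prod.ext (Prod.ext (funext fun j => ?_) rfl) (funext fun j => ?_)
    · simp [not_le.mpr j.2]
    · simp [j.2]

theorem conditional_eq (V : Processing d N a) (k : Fin N) :
    conditional V k = (blockDiagonal fun h => (V k h : Matrix (Rest d N a k) (Rest d N a k) ℂ)).submatrix
      (splitEquiv k) (splitEquiv k) := by
  ext p q
  simp only [conditional, submatrix_apply, splitEquiv, Equiv.coe_fn_mk, blockDiagonal_apply]
  congr 1
  simp [funext_iff]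

theorem conditional_isometry (V : Processing d N a) (k : Fin N) :
    (conditional V k)ᴴ * conditional V k = 1 := by
  rw [conditional_eq, conjTranspose_submatrix, submatrix_mul_equiv, blockDiagonal_conjTranspose,
    ← blockDiagonal_mul]
  have : (fun h => ((V k h : Matrix (Rest d N a k) (Rest d N a k) ℂ))ᴴ *
      (V k h : Matrix (Rest d N a k) (Rest d N a k) ℂ)) = 1 :=
    funext fun h => Unitary.coe_star_mul_self (V k h)
  rw [this, blockDiagonal_one, submatrix_one_equiv]

theorem conditional_one (k : Fin N) : conditional (1 : Processing d N a) k = 1 := by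
  rw [conditional_eq]
  have : (fun h => (((1 : Processing d N a) k h : Matrix.unitaryGroup (Rest d N a k) ℂ) :
      Matrix (Rest d N a k) (Rest d N a k) ℂ)) = 1 := rfl
  rw [this, blockDiagonal_one, submatrix_one_equiv]

/-- The conditional unitary is block diagonal in the labels of the registers up to `k`, hence
preserves every function of those labels. -/
theorem conditional_commute (V : Processing d N a) {k l : Fin N} (hlk : l ≤ k) (D : Fin d → ℂ) :
    Commute (onRegister l (diagonal D)) (conditional V k) := by
  unfold Commute SemiconjBy
  rw [onRegister_diagonal]
  ext p q
  rw [diagonal_mul, mul_diagonal, conditional]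
  split_ifs with h
  · rw [h l hlk, mul_comm]
  · simp

theorem query_eq (U : Matrix (Fin d) (Fin d) ℂ) (k : Fin N)
    (X : Matrix (Idx d N a) (Idx d N a) ℂ) :
    query U k X = ∑ i, onRegister k (readout U i) * X * (onRegister k (readout U i))ᴴ := rfl

theorem sum_onRegister_readout (k : Fin N) {U : Matrix (Fin d) (Fin d) ℂ} (hU : U * Uᴴ = 1) :
    ∑ i, (onRegister k (readout U i) : Matrix (Idx d N a) (Idx d N a) ℂ)ᴴ *
      onRegister k (readout U i) = 1 := by
  simp only [onRegister_conjTranspose, onRegister_mul, ← onRegister_sum]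
  rw [← onRegister_one (a := a) k]
  congr 1
  simp only [readout_eq, conjTranspose_mul, conjTranspose_conjTranspose,
    diagonal_single_conjTranspose]
  calc ∑ i, U * diagonal (Pi.single i 1) * (diagonal (Pi.single i 1) * Uᴴ)
      = U * (∑ i, (1 : Fin d → ℂ) i • diagonal (Pi.single i 1)) * Uᴴ := by
        rw [Finset.mul_sum, Finset.sum_mul]
        refine Finset.sum_congr rfl fun i _ => ?_
        rw [Pi.one_apply, one_smul, ← Matrix.mul_assoc, Matrix.mul_assoc U,
          diagonal_single_mul_self]
    _ = 1 := by
        rw [sum_diagonal_single, Pi.one_def, diagonal_one, Matrix.mul_one, hU]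

/-- The phases `e i` on the Kraus operators of `P_1` leave that channel unchanged but alter the
overlap. Commutation moves the projection `|i⟩⟨i|` through `Vᴴ * G * V` and merges it with the one
on the other side, so the sum over labels collapses to a single unitary factor. -/
theorem coherentPair_step {Φ₁ Φ₂ : Matrix (Idx d N a) (Idx d N a) ℂ → Matrix (Idx d N a) (Idx d N a) ℂ}
    {G V : Matrix (Idx d N a) (Idx d N a) ℂ} (h : CoherentPair Φ₁ Φ₂ G) (hV : Vᴴ * V = 1)
    {U : Matrix (Fin d) (Fin d) ℂ} (hU : U * Uᴴ = 1) {e : Fin d → ℂ} (he : ∀ i, ‖e i‖ = 1)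
    (k : Fin N) (hG : ∀ D : Fin d → ℂ, Commute (onRegister k (diagonal D)) (Vᴴ * G * V)) :
    CoherentPair (fun X => Φ₁ (V * query 1 k X * Vᴴ)) (fun X => Φ₂ (V * query U k X * Vᴴ))
      (onRegister k (U * diagonal e) * (Vᴴ * G * V)) := by
  have he' : ∀ i, e i * star (e i) = 1 := fun i => by
    rw [Complex.star_def, Complex.mul_conj, Complex.normSq_eq_norm_sq, he i]
    simp
  refine h.comp (fun i => e i • (V * onRegister k (readout 1 i)))
    (fun i => V * onRegister k (readout U i)) ?_ ?_ ?_ ?_ ?_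
  · intro X
    rw [query_eq, Finset.mul_sum, Finset.sum_mul]
    refine Finset.sum_congr rfl fun i _ => ?_
    rw [conjTranspose_smul, Matrix.smul_mul, Matrix.smul_mul, Matrix.mul_smul, smul_smul, he',
      one_smul, conjTranspose_mul]
    simp only [Matrix.mul_assoc]
  · intro X
    rw [query_eq, Finset.mul_sum, Finset.sum_mul]
    refine Finset.sum_congr rfl fun i _ => ?_
    rw [conjTranspose_mul]
    simp only [Matrix.mul_assoc]
  · rw [← sum_onRegister_readout (a := a) k (U := 1) (by simp)]
    refine Finset.sum_congr rfl fun i _ => ?_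
    rw [conjTranspose_smul, Matrix.smul_mul, Matrix.mul_smul, smul_smul, mul_comm, he', one_smul,
      conjTranspose_mul, Matrix.mul_assoc, ← Matrix.mul_assoc Vᴴ, hV, Matrix.one_mul]
  · rw [← sum_onRegister_readout (a := a) k hU]
    refine Finset.sum_congr rfl fun i _ => ?_
    rw [conjTranspose_mul, Matrix.mul_assoc, ← Matrix.mul_assoc Vᴴ, hV, Matrix.one_mul]
  · calc ∑ i, (V * onRegister k (readout U i))ᴴ * G * (e i • (V * onRegister k (readout 1 i)))
        = ∑ i, onRegister k (e i • (U * diagonal (Pi.single i 1))) * (Vᴴ * G * V) := by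
          refine Finset.sum_congr rfl fun i _ => ?_
          have h1 : (onRegister k (readout U i) : Matrix (Idx d N a) (Idx d N a) ℂ)ᴴ =
              onRegister k (U * diagonal (Pi.single i 1)) := by
            rw [onRegister_conjTranspose, readout_eq, conjTranspose_mul, conjTranspose_conjTranspose,
              diagonal_single_conjTranspose]
          have h2 : readout (1 : Matrix (Fin d) (Fin d) ℂ) i = diagonal (Pi.single i 1) := by
            rw [readout_eq, conjTranspose_one, Matrix.mul_one]
          rw [conjTranspose_mul, h1, h2, Matrix.mul_smul, onRegister_smul, Matrix.smul_mul]
          congr 1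
          calc _ = onRegister k (U * diagonal (Pi.single i 1)) *
                ((Vᴴ * G * V) * onRegister k (diagonal (Pi.single i 1))) := by
                simp only [Matrix.mul_assoc]
            _ = _ := by
                rw [← (hG _).eq, ← Matrix.mul_assoc, onRegister_mul, Matrix.mul_assoc U,
                  diagonal_single_mul_self]
      _ = onRegister k (U * diagonal e) * (Vᴴ * G * V) := by
          rw [← Finset.sum_mul, ← onRegister_sum]
          simp only [← Matrix.mul_smul]
          rw [← Matrix.mul_sum, sum_diagonal_single]

/-- The commutation clause is the invariant that drives the induction: whatever happens after a
register was measured does not disturb its label, which is what `coherentPair_step` needs. -/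
theorem exists_coherentPair_foldl (V : Processing d N a) {U : Matrix (Fin d) (Fin d) ℂ}
    (hU : U * Uᴴ = 1) {e : Fin d → ℂ} (he : ∀ i, ‖e i‖ = 1) {α : ℝ} (hα : 0 ≤ α)
    (hW : ReLowerBound (Real.cos α) (U * diagonal e)) (l : List (Fin N))
    (hl : l.Pairwise (· < ·)) (hlα : l.length * α ≤ Real.pi) :
    ∃ G : Matrix (Idx d N a) (Idx d N a) ℂ,
      CoherentPair
        (fun σ => l.foldl (fun X k => conditional V k * query 1 k X * (conditional V k)ᴴ) σ)
        (fun σ => l.foldl (fun X k => conditional V k * query U k X * (conditional V k)ᴴ) σ) G ∧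
      Gᴴ * G = 1 ∧ ReLowerBound (Real.cos (l.length * α)) G ∧
      ∀ k, (∀ j ∈ l, k < j) → ∀ D : Fin d → ℂ, Commute (onRegister k (diagonal D)) G := by
  have hWW := isometry_mul_diagonal hU he
  -- The head of the list is the earliest query, so the induction runs backwards in time and `G` is
  -- the overlap of the later queries.
  induction l with
  | nil =>
    refine ⟨1, coherentPair_id, by simp, ?_, fun k _ D => Commute.one_right _⟩
    rw [reLowerBound_iff]
    simp
  | cons k l ih =>
    rw [List.pairwise_cons] at hl
    rw [List.length_cons, Nat.cast_succ, add_mul, one_mul] at hlα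
    obtain ⟨G, hG, hGG, hGα, hGc⟩ := ih hl.2 (by linarith)
    have hV := conditional_isometry V k
    have hV' : conditional V k * (conditional V k)ᴴ = 1 := mul_eq_one_comm.mp hV
    have hcomm : ∀ j ≤ k, (∀ i ∈ l, j < i) → ∀ D : Fin d → ℂ,
        Commute (onRegister j (diagonal D)) ((conditional V k)ᴴ * G * conditional V k) := by
      intro j hj hjl D
      refine Commute.mul_right (Commute.mul_right ?_ (hGc j hjl D)) (conditional_commute V hj D)
      have := conditional_commute V hj (star D)
      have h2 := congrArg conjTranspose this.eq
      rw [conjTranspose_mul, conjTranspose_mul, onRegister_conjTranspose, diagonal_conjTranspose,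
        star_star] at h2
      exact h2.symm
    have hX : ((conditional V k)ᴴ * G * conditional V k)ᴴ *
        ((conditional V k)ᴴ * G * conditional V k) = 1 := by
      simp only [conjTranspose_mul, conjTranspose_conjTranspose]
      calc _ = (conditional V k)ᴴ * (Gᴴ * ((conditional V k * (conditional V k)ᴴ) * G)) *
            conditional V k := by simp only [Matrix.mul_assoc]
        _ = 1 := by rw [hV', Matrix.one_mul, hGG, Matrix.mul_one, hV]
    refine ⟨onRegister k (U * diagonal e) * ((conditional V k)ᴴ * G * conditional V k),
      coherentPair_step hG hV hU he k (hcomm k le_rfl hl.1), ?_, ?_, ?_⟩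
    · rw [conjTranspose_mul, Matrix.mul_assoc, ← Matrix.mul_assoc (onRegister k _)ᴴ,
        onRegister_isometry k hWW, Matrix.one_mul, hX]
    · rw [List.length_cons, Nat.cast_succ, add_mul, one_mul, add_comm]
      exact ReLowerBound.mul hα (by positivity) (by linarith) (onRegister_isometry k hWW) hX
        (hW.onRegister k) (hGα.conj hV)
    · intro j hj D
      have hjk : j < k := hj k List.mem_cons_self
      exact (onRegister_commute hjk.ne _ _).mul_right
        (hcomm j hjk.le (fun i hi => hj i (List.mem_cons_of_mem _ hi)) D)

theorem adaptive_le (V : Processing d N a) {U : Matrix (Fin d) (Fin d) ℂ}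
    (hU : U * Uᴴ = 1) {e : Fin d → ℂ} (he : ∀ i, ‖e i‖ = 1) {α : ℝ} (hα : 0 ≤ α)
    (hW : ReLowerBound (Real.cos α) (U * diagonal e)) (hNα : N * α ≤ Real.pi) {p : ℝ}
    (hp : p ∈ unambiguousValues (adaptive V 1) (adaptive V U)) : p ≤ 1 - Real.cos (N * α) := by
  obtain ⟨G, hG, -, hGα, -⟩ := exists_coherentPair_foldl V hU he hα hW (List.finRange N)
    (List.pairwise_lt_finRange N) (by simpa using hNα)
  obtain ⟨-, σ, hσ, hpσ⟩ := hG.exists_le hp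
  have := hGα.re_trace_le hσ
  rw [List.length_finRange] at this
  linarith

/-- Only trace preservation matters, so the overlap `G` may be anything; this serves the cases with
optimum zero, where no angle bound is available. -/
theorem adaptive_le_one (V : Processing d N a) {U : Matrix (Fin d) (Fin d) ℂ}
    (hU : U * Uᴴ = 1) {p : ℝ}
    (hp : p ∈ unambiguousValues (adaptive V 1) (adaptive V U)) : p ≤ 1 := by
  have key : ∀ l : List (Fin N), ∃ G : Matrix (Idx d N a) (Idx d N a) ℂ, CoherentPair
      (fun σ => l.foldl (fun X k => conditional V k * query 1 k X * (conditional V k)ᴴ) σ)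
      (fun σ => l.foldl (fun X k => conditional V k * query U k X * (conditional V k)ᴴ) σ) G := by
    intro l
    induction l with
    | nil => exact ⟨1, coherentPair_id⟩
    | cons k l ih =>
      obtain ⟨G, hG⟩ := ih
      have : ∀ (W : Matrix (Fin d) (Fin d) ℂ), W * Wᴴ = 1 → ∑ i,
          (conditional V k * onRegister k (readout W i))ᴴ *
            (conditional V k * onRegister k (readout W i)) = 1 := by
        intro W hW
        rw [← sum_onRegister_readout (a := a) k hW]
        refine Finset.sum_congr rfl fun i _ => ?_
        rw [conjTranspose_mul, Matrix.mul_assoc, ← Matrix.mul_assoc (conditional V k)ᴴ,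
          conditional_isometry, Matrix.one_mul]
      have h2 : ∀ (W : Matrix (Fin d) (Fin d) ℂ) (X : Matrix (Idx d N a) (Idx d N a) ℂ),
          conditional V k * query W k X * (conditional V k)ᴴ =
            ∑ i, (conditional V k * onRegister k (readout W i)) * X *
              (conditional V k * onRegister k (readout W i))ᴴ := by
        intro W X
        rw [query_eq, Finset.mul_sum, Finset.sum_mul]
        simp only [conjTranspose_mul, Matrix.mul_assoc]
      exact ⟨_, hG.comp _ _ (h2 1) (h2 U) (this 1 (by simp)) (this U hU) rfl⟩
  obtain ⟨G, hG⟩ := key (List.finRange N)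
  exact (hG.exists_le hp).1

end Adaptive

/-! ### The lower bound for the minimized sum. -/

section Parallel

variable {d N a : ℕ}

/-- The tensor power is a product of single-factor unitaries, and each factor adds at most `α` to
the angle. -/
theorem tensorPower_reLowerBound {W : Matrix (Fin d) (Fin d) ℂ} (hW : Wᴴ * W = 1) {α : ℝ}
    (hα : 0 ≤ α) (hWα : ReLowerBound (Real.cos α) W) (hNα : N * α ≤ Real.pi) :
    ReLowerBound (Real.cos (N * α)) (tensorPower N W) := by
  have hk : ∀ k : Fin N, (tensorProd (Pi.mulSingle k W))ᴴ * tensorProd (Pi.mulSingle k W) = 1 := by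
    intro k
    rw [tensorProd_conjTranspose, tensorProd_mul, ← tensorProd_one]
    congr 1
    ext1 j
    by_cases h : j = k
    · subst h; simp [hW]
    · simp [Pi.mulSingle_eq_of_ne h]
  have hkα : ∀ k : Fin N, ReLowerBound (Real.cos α) (tensorProd (Pi.mulSingle k W)) := by
    intro k
    -- A one-dimensional ancilla transfers the bound for `onRegister` to a tensor product without
    -- ancilla.
    have h := (hWα.onRegister (a := 1) k).submatrix fun x : Fin N → Fin d => (x, (0 : Fin 1))
    unfold ReLowerBound
    convert h using 1
    ext x y
    simp [onRegister_eq, Matrix.one_apply, Prod.ext_iff]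
  have key : ∀ s : Finset (Fin N),
      (tensorProd fun k => if k ∈ s then W else 1)ᴴ * (tensorProd fun k => if k ∈ s then W else 1)
        = 1 ∧
      (s.card * α ≤ Real.pi →
        ReLowerBound (Real.cos (s.card * α)) (tensorProd fun k => if k ∈ s then W else 1)) := by
    intro s
    induction s using Finset.induction_on with
    | empty =>
      have : (tensorProd fun k : Fin N => if k ∈ (∅ : Finset (Fin N)) then W else 1) = 1 := by
        rw [← tensorProd_one]
        congr 1
      rw [this]
      refine ⟨by simp, fun _ => ?_⟩
      rw [reLowerBound_iff]
      simp
    | insert k s hk' ih =>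
      have : (tensorProd fun j => if j ∈ insert k s then W else 1) =
          tensorProd (Pi.mulSingle k W) * tensorProd fun j => if j ∈ s then W else 1 := by
        rw [tensorProd_mul]
        congr 1
        ext1 j
        by_cases h : j = k
        · subst h; simp [hk']
        · simp [h]
      rw [this]
      refine ⟨?_, fun h => ?_⟩
      · rw [conjTranspose_mul, Matrix.mul_assoc, ← Matrix.mul_assoc (tensorProd (Pi.mulSingle k W))ᴴ, hk,
          Matrix.one_mul, ih.1]
      · rw [Finset.card_insert_of_notMem hk', Nat.cast_succ, add_mul, one_mul, add_comm] at h ⊢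
        exact ReLowerBound.mul hα (by positivity) h (hk k) ih.1 (hkα k) (ih.2 (by linarith))
  simpa [tensorPower_eq] using (key Finset.univ).2 (by simpa using hNα)

/-- The product phases in `(U * diagonal e)^{⊗N}` do not change absolute values of diagonal entries,
so the sum dominates the real part of a trace. -/
theorem le_sum_norm_diag {U : Matrix (Fin d) (Fin d) ℂ}
    (hU : U * Uᴴ = 1) {e : Fin d → ℂ} (he : ∀ i, ‖e i‖ = 1) {α : ℝ} (hα : 0 ≤ α)
    (hW : ReLowerBound (Real.cos α) (U * diagonal e)) (hNα : N * α ≤ Real.pi)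
    {ρ : Matrix (Fin N → Fin d) (Fin N → Fin d) ℂ} (hρ : IsState ρ) :
    Real.cos (N * α) ≤ ∑ i, ‖(ρ * tensorPower N U) i i‖ := by
  have hWW := isometry_mul_diagonal hU he
  refine ((tensorPower_reLowerBound hWW hα hW hNα).re_trace_le hρ).trans ?_
  have : tensorPower N (U * diagonal e) = tensorPower N U * diagonal fun x => ∏ k, e (x k) := by
    ext x y
    simp [tensorPower, mul_diagonal, Finset.prod_mul_distrib]
  rw [this, ← Matrix.mul_assoc, trace, Complex.re_sum]
  refine Finset.sum_le_sum fun x _ => ?_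
  rw [diag_apply, mul_diagonal]
  refine (Complex.re_le_norm _).trans ?_
  rw [norm_mul, norm_prod]
  simp [he]

end Parallel

/-! ### Parallel schemes as adaptive schemes with trivial processing. -/

section ParallelSubsetAdaptive

variable {d N a : ℕ}

/-- Kraus operators of the composition are indexed by outcome strings; these become the product
basis labels of the parallel measurement. -/
theorem foldl_kraus {n κ : Type*} [Fintype n] [DecidableEq n] [Fintype κ] :
    ∀ (N : ℕ) (K : Fin N → κ → Matrix n n ℂ) (X : Matrix n n ℂ),
      (List.finRange N).foldl (fun X k => ∑ i, K k i * X * (K k i)ᴴ) X =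
        ∑ x : Fin N → κ, (List.finRange N).foldl (fun M k => K k (x k) * M) 1 * X *
          ((List.finRange N).foldl (fun M k => K k (x k) * M) 1)ᴴ := by
  intro N
  induction N with
  | zero => intro K X; simp
  | succ N ih =>
    intro K X
    rw [← (Fin.snocEquiv fun _ => κ).sum_comp, Fintype.sum_prod_type]
    simp only [List.finRange_succ_last, List.foldl_append, List.foldl_map, List.foldl_cons,
      List.foldl_nil]
    rw [ih fun k => K k.castSucc]
    refine Finset.sum_congr rfl fun i _ => ?_
    rw [Finset.mul_sum, Finset.sum_mul]
    refine Finset.sum_congr rfl fun x _ => ?_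
    simp only [Fin.snocEquiv, Equiv.coe_fn_mk, Fin.snoc_castSucc, Fin.snoc_last, conjTranspose_mul,
      Matrix.mul_assoc]

theorem foldl_onRegister (B : Fin N → Matrix (Fin d) (Fin d) ℂ) (l : List (Fin N))
    (hl : l.Nodup) :
    l.foldl (fun (M : Matrix (Idx d N a) (Idx d N a) ℂ) k => onRegister k (B k) * M) 1 =
      tensorProd (fun k => if k ∈ l then B k else 1) ⊗ₖ (1 : Matrix (Fin a) (Fin a) ℂ) := by
  induction l using List.reverseRecOn with
  | nil =>
    have : (fun k : Fin N => if k ∈ ([] : List (Fin N)) then B k else 1) = 1 := by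
      ext1 k
      simp
    rw [this, tensorProd_one, one_kronecker_one, List.foldl_nil]
  | append_singleton l k ih =>
    rw [List.nodup_append] at hl
    rw [List.foldl_append, List.foldl_cons, List.foldl_nil, ih hl.1, onRegister_eq,
      ← mul_kronecker_mul, tensorProd_mul, Matrix.one_mul]
    congr 2
    ext1 j
    by_cases h : j = k
    · subst h
      have : j ∉ l := fun hj => hl.2.2 j hj j (by simp) rfl
      simp [this]
    · simp [h]

theorem readout_tensorPower (U : Matrix (Fin d) (Fin d) ℂ) (x : Fin N → Fin d) :
    readout (tensorPower N U) x = tensorProd fun k => readout U (x k) := by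
  simp only [readout_eq, tensorPower_eq, tensorProd_conjTranspose]
  ext y z
  rw [diagonal_mul]
  simp only [tensorProd, diagonal_mul, Finset.prod_mul_distrib]
  congr 1
  by_cases h : y = x
  · simp [h]
  · obtain ⟨k, hk⟩ := Function.ne_iff.mp h
    rw [Pi.single_eq_of_ne h, Finset.prod_eq_zero (Finset.mem_univ k)]
    simp [hk]

theorem adaptive_one (U : Matrix (Fin d) (Fin d) ℂ) (σ : Matrix (Idx d N a) (Idx d N a) ℂ) :
    adaptive (1 : Processing d N a) U σ = measure (Fin a) (tensorPower N U) σ := by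
  unfold adaptive measure
  simp only [conditional_one, Matrix.one_mul, conjTranspose_one, Matrix.mul_one, query_eq]
  rw [foldl_kraus N fun k i => onRegister k (readout U i)]
  refine Finset.sum_congr rfl fun x _ => ?_
  rw [foldl_onRegister (fun k => readout U (x k)) _ (List.nodup_finRange N), readout_tensorPower]
  simp

theorem parallelValues_subset (U : Matrix (Fin d) (Fin d) ℂ) :
    parallelValues N U ⊆ adaptiveValues N U := by
  rintro p ⟨a, hp⟩
  refine ⟨a, 1, ?_⟩
  have h : ∀ W : Matrix (Fin d) (Fin d) ℂ,
      adaptive (1 : Processing d N a) W = measure (Fin a) (tensorPower N W) :=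
    fun W => funext (adaptive_one W)
  rwa [h, h]

end ParallelSubsetAdaptive

/-! ### Unambiguous discrimination of two vectors. -/

section TwoVectors

variable {a : Type*} [Fintype a] [DecidableEq a]

theorem star_dotProduct_self_eq (x : a → ℂ) : star x ⬝ᵥ x = ((star x ⬝ᵥ x).re : ℂ) :=
  Complex.ext rfl (by simpa using (Complex.nonneg_iff.mp (dotProduct_star_self_nonneg x)).2.symm)

theorem quadratic_vecMulVec (f x : a → ℂ) :
    star x ⬝ᵥ vecMulVec f (star f) *ᵥ x = ((‖star f ⬝ᵥ x‖ ^ 2 : ℝ) : ℂ) := by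
  rw [vecMulVec_mulVec, dotProduct_smul, star_dotProduct x f]
  simp [← Complex.mul_conj', mul_comm]

/-- With `u = ⟨f, x⟩` and `v = ⟨g, x⟩`, expand `0 ≤ ‖x - t u f - s v g‖²`; the hypothesis `h` at
`‖u‖`, `‖v‖` absorbs the quadratic terms. -/
theorem posSemidef_one_sub_sub {f g : a → ℂ} {t s c F G : ℝ} (ht : 0 ≤ t) (hs : 0 ≤ s)
    (hf : star f ⬝ᵥ f = F) (hg : star g ⬝ᵥ g = G) (hfg : ‖star f ⬝ᵥ g‖ = c)
    (h : ∀ u v : ℝ, t ^ 2 * F * u ^ 2 + s ^ 2 * G * v ^ 2 + 2 * (t * s * c * (u * v)) ≤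
      t * u ^ 2 + s * v ^ 2) :
    (1 - t • vecMulVec f (star f) - s • vecMulVec g (star g) : Matrix a a ℂ).PosSemidef := by
  refine posSemidef_of_re_nonneg ?_ fun x => ?_
  · refine (isHermitian_one.sub ?_).sub ?_
    · exact ((posSemidef_vecMulVec_self_star f).smul ht).isHermitian
    · exact ((posSemidef_vecMulVec_self_star g).smul hs).isHermitian
  have e1 : (star x ⬝ᵥ (1 - t • vecMulVec f (star f) - s • vecMulVec g (star g) : Matrix a a ℂ)
      *ᵥ x).re = (star x ⬝ᵥ x).re - t * ‖star f ⬝ᵥ x‖ ^ 2 - s * ‖star g ⬝ᵥ x‖ ^ 2 := by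
    rw [sub_mulVec, sub_mulVec, dotProduct_sub, dotProduct_sub, one_mulVec, smul_mulVec,
      smul_mulVec, dotProduct_smul, dotProduct_smul, quadratic_vecMulVec, quadratic_vecMulVec,
      Complex.sub_re, Complex.sub_re, Complex.smul_re, Complex.smul_re, Complex.ofReal_re,
      Complex.ofReal_re, smul_eq_mul, smul_eq_mul]
  rw [e1]
  set u := star f ⬝ᵥ x with hu
  set v := star g ⬝ᵥ x with hv
  have hu' : star x ⬝ᵥ f = star u := star_dotProduct x f
  have hv' : star x ⬝ᵥ g = star v := star_dotProduct x g
  have hgf : star g ⬝ᵥ f = star (star f ⬝ᵥ g) := star_dotProduct g f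
  set k := star f ⬝ᵥ g with hk
  have e2 := (Complex.nonneg_iff.mp
    (dotProduct_star_self_nonneg (x - ((t : ℂ) * u) • f - ((s : ℂ) * v) • g))).1
  have e3 : star (x - ((t : ℂ) * u) • f - ((s : ℂ) * v) • g) ⬝ᵥ
      (x - ((t : ℂ) * u) • f - ((s : ℂ) * v) • g) = star x ⬝ᵥ x
        - 2 * t * (u * star u) - 2 * s * (v * star v)
        + t ^ 2 * F * (u * star u) + s ^ 2 * G * (v * star v)
        + t * s * (star u * v * k + star (star u * v * k)) := by
    simp only [star_sub, star_smul, sub_dotProduct, dotProduct_sub, smul_dotProduct,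
      dotProduct_smul, smul_eq_mul, star_mul', ← hu, ← hv, hu', hv', hgf, hf, hg, ← hk, star_star]
    simp only [Complex.star_def, Complex.conj_ofReal]
    ring
  have e4 : ∀ z : ℂ, z * star z = ((‖z‖ ^ 2 : ℝ) : ℂ) := fun z => by
    rw [Complex.star_def, Complex.mul_conj']
    push_cast
    rfl
  have e5 : (star u * v * k + star (star u * v * k)) = ((2 * (star u * v * k).re : ℝ) : ℂ) := by
    rw [Complex.star_def, Complex.add_conj]
  have e6 : (star (x - ((t : ℂ) * u) • f - ((s : ℂ) * v) • g) ⬝ᵥ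
      (x - ((t : ℂ) * u) • f - ((s : ℂ) * v) • g)).re = (star x ⬝ᵥ x).re
        - 2 * t * ‖u‖ ^ 2 - 2 * s * ‖v‖ ^ 2
        + t ^ 2 * F * ‖u‖ ^ 2 + s ^ 2 * G * ‖v‖ ^ 2
        + t * s * (2 * (star u * v * k).re) := by
    rw [e3, e5, e4, e4, star_dotProduct_self_eq x]
    norm_cast
  have e7 : (star u * v * k).re ≤ c * (‖u‖ * ‖v‖) := by
    refine (Complex.re_le_norm _).trans (le_of_eq ?_)
    rw [norm_mul, norm_mul, norm_star, hfg]
    ring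
  have e8 := mul_le_mul_of_nonneg_left e7 (mul_nonneg ht hs)
  have e9 := h ‖u‖ ‖v‖
  rw [e6] at e2
  nlinarith

/-- Optimal unambiguous discrimination of two unnormalized pure states, when their overlap does
not exceed their weights. -/
theorem exists_unambiguous_povm {φ χ : a → ℂ} (hφ : ‖star χ ⬝ᵥ φ‖ ≤ (star φ ⬝ᵥ φ).re)
    (hχ : ‖star χ ⬝ᵥ φ‖ ≤ (star χ ⬝ᵥ χ).re) :
    ∃ M₁ M₂ M₀ : Matrix a a ℂ, M₁.PosSemidef ∧ M₂.PosSemidef ∧ M₀.PosSemidef ∧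
      M₁ + M₂ + M₀ = 1 ∧ star φ ⬝ᵥ M₂ *ᵥ φ = 0 ∧ star χ ⬝ᵥ M₁ *ᵥ χ = 0 ∧
      star φ ⬝ᵥ M₁ *ᵥ φ = star φ ⬝ᵥ φ - ‖star χ ⬝ᵥ φ‖ ∧
      star χ ⬝ᵥ M₂ *ᵥ χ = star χ ⬝ᵥ χ - ‖star χ ⬝ᵥ φ‖ := by
  have hp := star_dotProduct_self_eq φ
  have hq := star_dotProduct_self_eq χ
  have hk' : star φ ⬝ᵥ χ = star (star χ ⬝ᵥ φ) := star_dotProduct φ χ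
  set p := (star φ ⬝ᵥ φ).re
  set q := (star χ ⬝ᵥ χ).re
  set k := star χ ⬝ᵥ φ
  set c := ‖k‖ with hc
  have hc0 : 0 ≤ c := norm_nonneg _
  have hkk : k * star k = (c : ℂ) ^ 2 := by rw [Complex.star_def, Complex.mul_conj']
  -- `Δ` is the Gram determinant. If it vanishes, `c ≤ p` and `c ≤ q` leave only a zero vector or `p
  -- = q = c`, where trivial measurements suffice.
  by_cases hΔ : p * q - c ^ 2 = 0
  · by_cases hq0 : q = 0
    · have : c = 0 := by linarith
      exact ⟨1, 0, 0, .one, .zero, .zero, by simp, by simp, by simp [hq, hq0], by simp [this],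
        by simp [hq, hq0, this]⟩
    · have hq1 : 0 < q := lt_of_le_of_ne (hc0.trans hχ) (Ne.symm hq0)
      have h1 : (p - c) * q + c * (q - c) = 0 := by linarith
      have h2 : 0 ≤ (p - c) * q := mul_nonneg (by linarith) hq1.le
      have h3 : 0 ≤ c * (q - c) := mul_nonneg hc0 (by linarith)
      have h4 : p = c := by
        have : (p - c) * q = 0 := by linarith
        rcases mul_eq_zero.mp this with h | h <;> [linarith; exact absurd h hq0]
      have h5 : c * (q - c) = 0 := by linarith
      rcases mul_eq_zero.mp h5 with h | h
      · exact ⟨0, 1, 0, .zero, .one, .zero, by simp, by simp [hp, h4, h], by simp,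
          by simp [hp, h4, h], by simp [h]⟩
      · have h6 : q = c := by linarith
        exact ⟨0, 0, 1, .zero, .zero, .one, by simp, by simp, by simp, by simp [hp, h4],
          by simp [hq, h6]⟩
  · have hΔ0 : 0 < p * q - c ^ 2 := by
      refine lt_of_le_of_ne ?_ (Ne.symm hΔ)
      nlinarith [mul_nonneg (sub_nonneg.mpr hφ) (hc0.trans hχ), mul_nonneg hc0 (sub_nonneg.mpr hχ)]
    set Δ := p * q - c ^ 2 with hΔdef
    have hΔC : (Δ : ℂ) = p * q - c ^ 2 := by rw [hΔdef]; push_cast; rfl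
    -- `f` is orthogonal to `χ` and `g` to `φ`, each with overlap `Δ` with its own vector; the
    -- weights `(p - c) / Δ²` and `(q - c) / Δ²` then give the claimed values.
    set f : a → ℂ := (q : ℂ) • φ - k • χ with hfdef
    set g : a → ℂ := (p : ℂ) • χ - star k • φ with hgdef
    have fφ : star f ⬝ᵥ φ = Δ := by
      simp only [hfdef, star_sub, star_smul, sub_dotProduct, smul_dotProduct, smul_eq_mul, hp]
      change star (q : ℂ) * p - star k * k = Δ
      rw [hΔC, ← hkk, Complex.star_def, Complex.conj_ofReal]
      ring
    have fχ : star f ⬝ᵥ χ = 0 := by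
      simp only [hfdef, star_sub, star_smul, sub_dotProduct, smul_dotProduct, smul_eq_mul, hq, hk']
      simp only [Complex.star_def, Complex.conj_ofReal]
      ring
    have gχ : star g ⬝ᵥ χ = Δ := by
      simp only [hgdef, star_sub, star_smul, sub_dotProduct, smul_dotProduct, smul_eq_mul, hq, hk']
      rw [hΔC, ← hkk, star_star, Complex.star_def, Complex.conj_ofReal]
    have gφ : star g ⬝ᵥ φ = 0 := by
      simp only [hgdef, star_sub, star_smul, sub_dotProduct, smul_dotProduct, smul_eq_mul, hp]
      change star (p : ℂ) * k - star (star k) * p = 0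
      rw [star_star, Complex.star_def, Complex.conj_ofReal]
      ring
    have ff : star f ⬝ᵥ f = ((q * Δ : ℝ) : ℂ) := by
      conv_lhs => rw [hfdef, dotProduct_sub, dotProduct_smul, dotProduct_smul, ← hfdef, fφ, fχ]
      simp
    have gg : star g ⬝ᵥ g = ((p * Δ : ℝ) : ℂ) := by
      conv_lhs =>
        enter [2]
        rw [hgdef]
      rw [dotProduct_sub, dotProduct_smul, dotProduct_smul, gφ, gχ]
      simp
    have fg : ‖star f ⬝ᵥ g‖ = c * Δ := by
      conv_lhs =>
        enter [1, 2]
        rw [hgdef]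
      rw [dotProduct_sub, dotProduct_smul, dotProduct_smul, fφ, fχ]
      simp [abs_of_pos hΔ0, hc]
    have ht : 0 ≤ (p - c) / Δ ^ 2 := div_nonneg (by linarith) (by positivity)
    have hs : 0 ≤ (q - c) / Δ ^ 2 := div_nonneg (by linarith) (by positivity)
    refine ⟨((p - c) / Δ ^ 2) • vecMulVec f (star f), ((q - c) / Δ ^ 2) • vecMulVec g (star g),
      1 - ((p - c) / Δ ^ 2) • vecMulVec f (star f) - ((q - c) / Δ ^ 2) • vecMulVec g (star g),
      (posSemidef_vecMulVec_self_star f).smul ht, (posSemidef_vecMulVec_self_star g).smul hs,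
      posSemidef_one_sub_sub ht hs ff gg fg ?_, by abel, ?_, ?_, ?_, ?_⟩
    · intro u v
      have hid : (p - c) / Δ ^ 2 * u ^ 2 + (q - c) / Δ ^ 2 * v ^ 2 -
          (((p - c) / Δ ^ 2) ^ 2 * (q * Δ) * u ^ 2 + ((q - c) / Δ ^ 2) ^ 2 * (p * Δ) * v ^ 2 +
            2 * ((p - c) / Δ ^ 2 * ((q - c) / Δ ^ 2) * (c * Δ) * (u * v))) =
          c * (p - c) * (q - c) / Δ ^ 3 * (u - v) ^ 2 := by
        have : Δ ≠ 0 := hΔ0.ne'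
        field_simp
        rw [hΔdef]
        ring
      have : 0 ≤ c * (p - c) * (q - c) / Δ ^ 3 * (u - v) ^ 2 :=
        mul_nonneg (div_nonneg (mul_nonneg (mul_nonneg hc0 (by linarith)) (by linarith))
          (by positivity)) (sq_nonneg _)
      linarith
    · rw [smul_mulVec, dotProduct_smul, quadratic_vecMulVec, gφ]
      simp
    · rw [smul_mulVec, dotProduct_smul, quadratic_vecMulVec, fχ]
      simp
    · rw [smul_mulVec, dotProduct_smul, quadratic_vecMulVec, fφ, hp, Complex.norm_real,
        Real.norm_eq_abs, sq_abs, Complex.real_smul, ← Complex.ofReal_mul,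
        div_mul_cancel₀ _ (by positivity)]
      push_cast
      rfl
    · rw [smul_mulVec, dotProduct_smul, quadratic_vecMulVec, gχ, hq, Complex.norm_real,
        Real.norm_eq_abs, sq_abs, Complex.real_smul, ← Complex.ofReal_mul,
        div_mul_cancel₀ _ (by positivity)]
      push_cast
      rfl

end TwoVectors

/-! ### A strategy from a state with dominated overlaps. -/

section Achievability

variable {n a : Type*} [Fintype n] [DecidableEq n] [Fintype a] [DecidableEq a]

/-- The measurement that applies `M i` to the ancilla when the classical label is `i`. -/
def controlled (M : n → Matrix a a ℂ) : Matrix (n × a) (n × a) ℂ :=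
  ∑ i, diagonal (Pi.single i 1) ⊗ₖ M i

theorem controlled_posSemidef {M : n → Matrix a a ℂ} (hM : ∀ i, (M i).PosSemidef) :
    (controlled M).PosSemidef := by
  refine posSemidef_sum _ fun i _ => PosSemidef.kronecker (.diagonal ?_) (hM i)
  intro j
  by_cases h : j = i <;> simp [h]

theorem controlled_add (M M' : n → Matrix a a ℂ) :
    controlled (M + M') = controlled M + controlled M' := by
  simp [controlled, kronecker_add, Finset.sum_add_distrib]

theorem controlled_one : controlled (1 : n → Matrix a a ℂ) = 1 := by
  ext p q
  simp [controlled, Matrix.sum_apply, Matrix.one_apply, diagonal_apply, Pi.single_apply,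
    Prod.ext_iff, ite_and]
  split_ifs <;> rfl

theorem kronecker_mulVec_apply (A : Matrix n n ℂ) (B : Matrix a a ℂ) (ψ : n × a → ℂ) (p : n × a) :
    ((A ⊗ₖ B) *ᵥ ψ) p = ∑ y, ∑ s, A p.1 y * B p.2 s * ψ (y, s) := by
  simp [mulVec, dotProduct, Fintype.sum_prod_type]

theorem quadratic_controlled (M : n → Matrix a a ℂ) (i : n) (χ : a → ℂ) :
    star (fun p : n × a => if p.1 = i then χ p.2 else 0) ⬝ᵥ controlled M *ᵥ
      (fun p : n × a => if p.1 = i then χ p.2 else 0) = star χ ⬝ᵥ M i *ᵥ χ := by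
  have h1 : (diagonal (Pi.single i (1 : ℂ)) ⊗ₖ M i) *ᵥ (fun p : n × a => if p.1 = i then χ p.2 else 0) =
      fun p => if p.1 = i then (M i *ᵥ χ) p.2 else 0 := by
    ext p
    rw [kronecker_mulVec_apply]
    by_cases h : p.1 = i
    · simp [h, diagonal_apply, mulVec, dotProduct]
    · simp [h, diagonal_apply]
  have h2 : ∀ j, j ≠ i → (diagonal (Pi.single j (1 : ℂ)) ⊗ₖ M j) *ᵥ
      (fun p : n × a => if p.1 = i then χ p.2 else 0) = 0 := by
    intro j hj
    ext p
    rw [kronecker_mulVec_apply]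
    refine Finset.sum_eq_zero fun y _ => Finset.sum_eq_zero fun s _ => ?_
    by_cases h : y = i
    · simp [h, diagonal_apply, Pi.single_apply]
      intro h3 h4
      exact absurd (h4.symm.trans h3) hj
    · simp [h]
  rw [controlled, sum_mulVec, Finset.sum_eq_single i (fun j _ hj => h2 j hj) (by simp), h1]
  simp [dotProduct, Fintype.sum_prod_type]

theorem trace_mul_vecMulVec (M : Matrix n n ℂ) (v : n → ℂ) :
    (M * vecMulVec v (star v)).trace = star v ⬝ᵥ M *ᵥ v := by
  rw [mul_vecMulVec, trace_vecMulVec, dotProduct_comm]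

theorem readout_kronecker_mulVec (W : Matrix n n ℂ) (i : n) (ψ : n × a → ℂ) :
    (readout W i ⊗ₖ (1 : Matrix a a ℂ)) *ᵥ ψ =
      fun p => if p.1 = i then ∑ y, star (W y i) * ψ (y, p.2) else 0 := by
  ext p
  rw [kronecker_mulVec_apply]
  by_cases h : p.1 = i
  · simp [h, readout, vecMulVec_apply, Matrix.one_apply]
  · simp [h, readout, vecMulVec_apply]

/-- Label `i` leaves the ancilla in the unnormalized vector `(⟨W i| ⊗ 1) ψ`, on which `M i` is
measured. -/
theorem trace_controlled_mul_measure (M : n → Matrix a a ℂ) (W : Matrix n n ℂ) (ψ : n × a → ℂ) :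
    (controlled M * measure a W (vecMulVec ψ (star ψ))).trace =
      ∑ i, star (fun s => ∑ y, star (W y i) * ψ (y, s)) ⬝ᵥ
        M i *ᵥ (fun s => ∑ y, star (W y i) * ψ (y, s)) := by
  rw [measure, Finset.mul_sum, trace_sum]
  refine Finset.sum_congr rfl fun i _ => ?_
  rw [mul_vecMulVec, vecMulVec_mul, ← star_mulVec, trace_mul_vecMulVec, readout_kronecker_mulVec]
  exact quadratic_controlled M i fun s => ∑ y, star (W y i) * ψ (y, s)

theorem exists_unambiguousValue {ρ W : Matrix n n ℂ} (hρ : IsState ρ) (hW : W * Wᴴ = 1)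
    (h₁ : ∀ i, ‖(ρ * W) i i‖ ≤ (ρ i i).re) (h₂ : ∀ i, ‖(ρ * W) i i‖ ≤ ((Wᴴ * ρ * W) i i).re) :
    1 - ∑ i, ‖(ρ * W) i i‖ ∈
      unambiguousValues (measure (Fin (Fintype.card n)) 1) (measure (Fin (Fintype.card n)) W) := by
  obtain ⟨B, hB⟩ := exists_eq_conjTranspose_mul_self hρ.1
  let e := Fintype.equivFin n
  -- A purification of `ρ = Bᴴ * B`. The residual ancilla vectors have label probabilities as
  -- squared norms and the entries `(ρ * W) i i` as overlaps.
  let ψ : n × Fin (Fintype.card n) → ℂ := fun p => star (B (e.symm p.2) p.1)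
  let χ : Matrix n n ℂ → n → Fin (Fintype.card n) → ℂ :=
    fun V i s => ∑ y, star (V y i) * ψ (y, s)
  have hχ : ∀ V V' i, star (χ V' i) ⬝ᵥ χ V i = (Vᴴ * ρ * V') i i := by
    intro V V' i
    have : Vᴴ * ρ * V' = (B * V)ᴴ * (B * V') := by
      rw [hB, conjTranspose_mul]
      simp only [Matrix.mul_assoc]
    have hc : ∀ V s, χ V i s = star ((B * V) (e.symm s) i) := by
      intro V s
      simp only [χ, ψ, Matrix.mul_apply, star_sum, star_mul']
      exact Finset.sum_congr rfl fun y _ => mul_comm _ _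
    rw [this, Matrix.mul_apply, ← e.symm.sum_comp]
    simp only [dotProduct, Pi.star_apply, hc, star_star, conjTranspose_apply]
    exact Finset.sum_congr rfl fun y _ => mul_comm _ _
  have hφφ : ∀ i, star (χ 1 i) ⬝ᵥ χ 1 i = ρ i i := fun i => by simp [hχ]
  have hχφ : ∀ i, star (χ W i) ⬝ᵥ χ 1 i = (ρ * W) i i := fun i => by simp [hχ]
  have hχχ : ∀ i, star (χ W i) ⬝ᵥ χ W i = (Wᴴ * ρ * W) i i := fun i => hχ _ _ _
  choose M₁ M₂ M₀ hM₁ hM₂ hM₀ hsum h21 h12 h11 h22 using fun i =>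
    exists_unambiguous_povm (φ := χ 1 i) (χ := χ W i) (by rw [hχφ, hφφ]; exact h₁ i)
      (by rw [hχφ, hχχ]; exact h₂ i)
  refine ⟨vecMulVec ψ (star ψ), controlled M₁, controlled M₂, controlled M₀,
    ⟨posSemidef_vecMulVec_self_star ψ, ?_⟩, controlled_posSemidef hM₁, controlled_posSemidef hM₂,
    controlled_posSemidef hM₀, ?_, ?_, ?_, ?_⟩
  · rw [← hρ.2, trace_vecMulVec, trace]
    simp only [diag_apply, dotProduct, Fintype.sum_prod_type, Pi.star_apply]
    refine Finset.sum_congr rfl fun i _ => ?_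
    rw [hB, Matrix.mul_apply, ← e.symm.sum_comp]
    simp [ψ]
  · rw [← controlled_add, ← controlled_add, ← controlled_one]
    exact congrArg _ (funext hsum)
  · rw [trace_controlled_mul_measure]
    exact Finset.sum_eq_zero fun i _ => h21 i
  · rw [trace_controlled_mul_measure]
    exact Finset.sum_eq_zero fun i _ => h12 i
  · have e₁ : ∑ i, ρ i i = 1 := hρ.2
    have e₂ : ∑ i, (Wᴴ * ρ * W) i i = 1 := by
      change (Wᴴ * ρ * W).trace = 1
      rw [Matrix.mul_assoc, Matrix.trace_mul_comm, Matrix.mul_assoc, hW, Matrix.mul_one, hρ.2]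
    rw [trace_controlled_mul_measure, trace_controlled_mul_measure,
      Finset.sum_congr rfl fun i _ => h11 i, Finset.sum_congr rfl fun i _ => h22 i]
    simp only [hφφ, hχφ, hχχ, Finset.sum_sub_distrib, e₁, e₂]
    push_cast
    ring

end Achievability

/-! ### Convexity and compactness of the set of states. -/

section States

variable {n : Type*} [Fintype n] [DecidableEq n]

theorem convex_isState : Convex ℝ {ρ : Matrix n n ℂ | IsState ρ} := by
  intro ρ hρ τ hτ a b ha hb hab
  refine ⟨(hρ.1.smul ha).add (hτ.1.smul hb), ?_⟩
  rw [trace_add, trace_smul, trace_smul, hρ.2, hτ.2, ← add_smul, hab, one_smul]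

theorem IsState.re_diag_le_one {ρ : Matrix n n ℂ} (hρ : IsState ρ) (i : n) : (ρ i i).re ≤ 1 := by
  have h : ∑ j, (ρ j j).re = 1 := by
    rw [← Complex.re_sum]
    exact congrArg Complex.re hρ.2
  rw [← h]
  exact Finset.single_le_sum (f := fun j => (ρ j j).re)
    (fun j _ => re_diag_nonneg hρ.1 _) (Finset.mem_univ i)

theorem IsState.norm_apply_le_one {ρ : Matrix n n ℂ} (hρ : IsState ρ) (i j : n) :
    ‖ρ i j‖ ≤ 1 := by
  obtain ⟨B, hB⟩ := exists_eq_conjTranspose_mul_self hρ.1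
  have hdiag : ∀ i, ∑ k, ‖B k i‖ ^ 2 ≤ 1 := by
    intro i
    refine le_of_eq_of_le ?_ (hρ.re_diag_le_one i)
    rw [hB, Matrix.mul_apply, Complex.re_sum]
    refine Finset.sum_congr rfl fun k _ => ?_
    rw [conjTranspose_apply, Complex.star_def, Complex.conj_mul']
    norm_cast
  calc ‖ρ i j‖ ≤ ∑ k, ‖B k i‖ * ‖B k j‖ := by
        rw [hB, Matrix.mul_apply]
        refine (norm_sum_le _ _).trans (le_of_eq (Finset.sum_congr rfl fun k _ => ?_))
        rw [norm_mul, conjTranspose_apply, norm_star]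
    _ ≤ ∑ k, (‖B k i‖ ^ 2 + ‖B k j‖ ^ 2) / 2 :=
        Finset.sum_le_sum fun k _ => by nlinarith [sq_nonneg (‖B k i‖ - ‖B k j‖)]
    _ ≤ 1 := by
        rw [← Finset.sum_div, Finset.sum_add_distrib]
        linarith [hdiag i, hdiag j]

theorem isCompact_isState : IsCompact {ρ : Matrix n n ℂ | IsState ρ} := by
  have hK : IsCompact {ρ : Matrix n n ℂ | ∀ i j, ‖ρ i j‖ ≤ 1} := by
    have h : IsCompact (Set.univ.pi fun _ : n => Set.univ.pi fun _ : n =>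
        Metric.closedBall (0 : ℂ) 1) :=
      isCompact_univ_pi fun _ => isCompact_univ_pi fun _ => isCompact_closedBall 0 1
    have e : {ρ : Matrix n n ℂ | ∀ i j, ‖ρ i j‖ ≤ 1} = (Set.univ.pi fun _ : n =>
        Set.univ.pi fun _ : n => Metric.closedBall (0 : ℂ) 1) := by
      ext ρ
      exact ⟨fun h i _ j _ => by simpa using h i j, fun h i j => by
        simpa using h i trivial j trivial⟩
    rw [e]
    exact h
  refine hK.of_isClosed_subset ?_ fun ρ hρ => hρ.norm_apply_le_one
  · have : {ρ : Matrix n n ℂ | IsState ρ} = {ρ | ρᴴ = ρ} ∩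
        (⋂ x : n → ℂ, {ρ | 0 ≤ (star x ⬝ᵥ ρ *ᵥ x).re}) ∩ {ρ | ρ.trace = 1} := by
      ext ρ
      simp only [Set.mem_ofPred_eq, Set.mem_inter_iff, Set.mem_iInter]
      constructor
      · exact fun h => ⟨⟨h.1.isHermitian, fun x =>
          (Complex.nonneg_iff.mp (h.1.dotProduct_mulVec_nonneg x)).1⟩, h.2⟩
      · exact fun h => ⟨posSemidef_of_re_nonneg h.1.1 h.1.2, h.2⟩
    rw [this]
    refine IsClosed.inter (IsClosed.inter ?_ (isClosed_iInter fun x => ?_)) ?_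
    · exact isClosed_eq (by fun_prop) continuous_id
    · refine isClosed_le continuous_const (Complex.continuous_re.comp ?_)
      exact Continuous.dotProduct continuous_const (Continuous.matrix_mulVec continuous_id continuous_const)
    · exact isClosed_eq (Continuous.matrix_trace continuous_id) continuous_const

theorem isState_diagonal_single (i : n) : IsState (diagonal (Pi.single i (1 : ℂ))) := by
  refine ⟨.diagonal fun j => ?_, by simp [trace_diagonal]⟩
  by_cases h : j = i <;> simp [h]

theorem exists_isState_min [Nonempty n] (U : Matrix n n ℂ) :
    ∃ ρ : Matrix n n ℂ, IsState ρ ∧ ∀ τ : Matrix n n ℂ, IsState τ → ∑ i, ‖(ρ * U) i i‖ ≤ ∑ i, ‖(τ * U) i i‖ := by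
  obtain ⟨ρ, hρ, h⟩ := isCompact_isState.exists_isMinOn
    (f := fun ρ : Matrix n n ℂ => ∑ i, ‖(ρ * U) i i‖)
    ⟨_, isState_diagonal_single (Classical.arbitrary n)⟩ (by
      refine Continuous.continuousOn (continuous_finsetSum _ fun i _ => Continuous.norm ?_)
      exact (Continuous.matrix_mul continuous_id continuous_const).matrix_elem i i)
  exact ⟨ρ, hρ, fun τ hτ => h hτ⟩

end States

/-! ### Duality: optimal diagonal contractions. -/

section Separation

variable {n : Type*} [Fintype n] [DecidableEq n]

/-- The open `ℓ¹` ball of radius `m` misses the convex set of diagonals of `ρ * U`. A separating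
functional is an `ℓ^∞` vector, and rescaling it gives the contraction. -/
theorem exists_contraction_of_le {U : Matrix n n ℂ} {m : ℝ} (hm : 0 < m)
    (h : ∀ ρ : Matrix n n ℂ, IsState ρ → m ≤ ∑ i, ‖(ρ * U) i i‖) :
    ∃ E : n → ℂ, (∀ i, ‖E i‖ ≤ 1) ∧ ∀ ρ, IsState ρ → m ≤ (ρ * (U * diagonal E)).trace.re := by
  by_cases hne : Nonempty n
  swap
  · rw [not_nonempty_iff] at hne
    exact ⟨0, fun i => (hne.false i).elim, fun ρ hρ => by simpa [trace] using hρ.2⟩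
  have hball : Convex ℝ {v : n → ℂ | ∑ i, ‖v i‖ < m} := by
    intro v hv w hw a b ha hb hab
    simp only [Set.mem_ofPred_eq] at hv hw ⊢
    calc ∑ i, ‖(a • v + b • w) i‖ ≤ ∑ i, (a * ‖v i‖ + b * ‖w i‖) := by
          refine Finset.sum_le_sum fun i _ => (norm_add_le _ _).trans (le_of_eq ?_)
          rw [Pi.smul_apply, Pi.smul_apply, norm_smul, norm_smul, Real.norm_of_nonneg ha,
            Real.norm_of_nonneg hb]
      _ = a * ∑ i, ‖v i‖ + b * ∑ i, ‖w i‖ := by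
          rw [Finset.sum_add_distrib, Finset.mul_sum, Finset.mul_sum]
      _ < m := by
          rcases ha.eq_or_lt with rfl | ha'
          · rw [zero_add] at hab
            subst hab
            linarith
          · have h1 := mul_lt_mul_of_pos_left hv ha'
            have h2 := mul_le_mul_of_nonneg_left hw.le hb
            have h3 : a * m + b * m = m := by rw [← add_mul, hab, one_mul]
            linarith
  have hopen : IsOpen {v : n → ℂ | ∑ i, ‖v i‖ < m} :=
    isOpen_lt (by fun_prop) continuous_const
  have hK : Convex ℝ ((fun ρ : Matrix n n ℂ => fun i => (ρ * U) i i) '' {ρ | IsState ρ}) := by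
    refine convex_isState.is_linear_image ⟨fun ρ τ => ?_, fun c ρ => ?_⟩
    · ext i
      simp [Matrix.add_mul]
    · ext i
      simp
  have hdisj : Disjoint {v : n → ℂ | ∑ i, ‖v i‖ < m}
      ((fun ρ : Matrix n n ℂ => fun i => (ρ * U) i i) '' {ρ | IsState ρ}) := by
    rw [Set.disjoint_left]
    rintro v hv ⟨ρ, hρ, rfl⟩
    exact absurd (h ρ hρ) (not_le.mpr hv)
  obtain ⟨f, u, hf, hfK⟩ := geometric_hahn_banach_open hball hopen hK hdisj
  have hu : 0 < u := by simpa using hf 0 (by simpa using hm)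
  -- The complex coefficients of the real-linear functional `f`, chosen so that `f v = Re ∑ E i * v
  -- i`.
  let E : n → ℂ := fun i => f (Pi.single i 1) - Complex.I * f (Pi.single i Complex.I)
  have hfz : ∀ i (z : ℂ), f (Pi.single i z) = (E i * z).re := by
    intro i z
    have hz : (Pi.single i z : n → ℂ) =
        z.re • (Pi.single i (1 : ℂ) : n → ℂ) + z.im • (Pi.single i Complex.I : n → ℂ) := by
      rw [← Pi.single_smul, ← Pi.single_smul, ← Pi.single_add]
      congr 1
      simp [Complex.re_add_im]
    rw [hz, map_add, map_smul, map_smul]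
    simp [E]
    ring
  clear_value E
  have hfv : ∀ v, f v = (∑ i, E i * v i).re := by
    intro v
    conv_lhs => rw [← Finset.univ_sum_single v]
    rw [map_sum, Complex.re_sum]
    exact Finset.sum_congr rfl fun i _ => hfz i (v i)
  have hE : ∀ i, m * ‖E i‖ ≤ u := by
    intro i
    by_cases h0 : E i = 0
    · simpa [h0] using hu.le
    have h0' : 0 < ‖E i‖ := norm_pos_iff.mpr h0
    refine le_of_forall_lt fun y hy => ?_
    by_cases hy0 : y ≤ 0
    · exact hy0.trans_lt hu
    push Not at hy0
    have hlt : y / ‖E i‖ < m := by rwa [div_lt_iff₀ h0']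
    -- A test vector in the ball, with phase opposite to that of `E i`, on which `f` takes the value
    -- `y`.
    have := hf (Pi.single i ((y / ‖E i‖ : ℝ) * (star (E i) / ‖E i‖))) (by
      simp only [Set.mem_ofPred_eq]
      rw [Finset.sum_eq_single i (fun j _ hj => by simp [hj]) (by simp)]
      rw [Pi.single_eq_same, norm_mul, norm_div, norm_star, Complex.norm_real, Complex.norm_real,
        norm_norm, div_self h0'.ne', mul_one, Real.norm_of_nonneg (by positivity)]
      exact hlt)
    rw [hfz] at this
    have e1 : E i * (((y / ‖E i‖ : ℝ) : ℂ) * (star (E i) / ‖E i‖)) = (y : ℂ) := by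
      have h2 : E i * star (E i) = (‖E i‖ : ℂ) ^ 2 := by rw [Complex.star_def, Complex.mul_conj']
      have h3 : (‖E i‖ : ℂ) ≠ 0 := by exact_mod_cast h0'.ne'
      push_cast
      field_simp
      exact h2
    rwa [e1, Complex.ofReal_re] at this
  refine ⟨fun i => ((m / u : ℝ) : ℂ) * E i, fun i => ?_, fun ρ hρ => ?_⟩
  · rw [norm_mul, Complex.norm_real, Real.norm_of_nonneg (by positivity), div_mul_eq_mul_div,
      div_le_one hu]
    exact hE i
  · have h1 := hfK _ ⟨ρ, hρ, rfl⟩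
    rw [hfv] at h1
    have h2 : (ρ * (U * diagonal fun i => ((m / u : ℝ) : ℂ) * E i)).trace =
        ((m / u : ℝ) : ℂ) * ∑ i, E i * (ρ * U) i i := by
      rw [← Matrix.mul_assoc, trace, Finset.mul_sum]
      refine Finset.sum_congr rfl fun i _ => ?_
      rw [diag_apply, mul_diagonal]
      ring
    rw [h2, Complex.re_ofReal_mul]
    calc m = m / u * u := by field_simp
      _ ≤ _ := mul_le_mul_of_nonneg_left h1 (by positivity)

theorem reLowerBound_of_forall_isState {W : Matrix n n ℂ} {m : ℝ}
    (h : ∀ ρ, IsState ρ → m ≤ (ρ * W).trace.re) : ReLowerBound m W := by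
  rw [reLowerBound_iff]
  intro x
  by_cases hx : x = 0
  · simp [hx]
  have hpos : 0 < (star x ⬝ᵥ x).re := by
    rw [← norm_toLp_sq]
    have : WithLp.toLp 2 x ≠ (0 : EuclideanSpace ℂ n) := by simpa using hx
    positivity
  have hs := h (((star x ⬝ᵥ x).re)⁻¹ • vecMulVec x (star x))
    ⟨(posSemidef_vecMulVec_self_star x).smul (inv_nonneg.mpr hpos.le), by
      rw [trace_smul, trace_vecMulVec, dotProduct_comm x, star_dotProduct_self_eq x,
        Complex.real_smul, Complex.ofReal_re, ← Complex.ofReal_mul, inv_mul_cancel₀ hpos.ne',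
        Complex.ofReal_one]⟩
  rw [Matrix.smul_mul, trace_smul, Matrix.trace_mul_comm, trace_mul_vecMulVec, Complex.smul_re,
    smul_eq_mul, inv_mul_eq_div, le_div_iff₀ hpos] at hs
  exact hs

end Separation

/-! ### From diagonal contractions to diagonal unitaries. -/

section Spectral

variable {n : Type*} [Fintype n] [DecidableEq n]

theorem normSq_eigenvalue {W : Matrix n n ℂ} (hW : Wᴴ * W = 1) {a : ℂ} {x : n → ℂ} (hx : x ≠ 0)
    (h : W *ᵥ x = a • x) : a * star a = 1 := by
  have h1 := norm_toLp_mulVec hW x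
  have h0 : WithLp.toLp 2 x ≠ (0 : EuclideanSpace ℂ n) := by simpa using hx
  rw [h, WithLp.toLp_smul, norm_smul, mul_eq_right₀ (norm_ne_zero_iff.mpr h0)] at h1
  rw [Complex.star_def, Complex.mul_conj', h1]
  simp

theorem exists_eigenvector {W : Matrix n n ℂ} {a : ℂ} (h : (W - a • (1 : Matrix n n ℂ)).det = 0) :
    ∃ x, x ≠ 0 ∧ W *ᵥ x = a • x := by
  obtain ⟨x, hx, h⟩ := exists_mulVec_eq_zero_iff.mpr h
  refine ⟨x, hx, ?_⟩
  rwa [sub_mulVec, smul_mulVec, one_mulVec, sub_eq_zero] at h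

/-- A lower bound on the real parts of the eigenvalues of a unitary bounds its Hermitian part. -/
theorem reLowerBound_of_eigenvalues {W : Matrix n n ℂ} (hW : Wᴴ * W = 1) {m : ℝ}
    (h : ∀ (a : ℂ) (x : n → ℂ), x ≠ 0 → W *ᵥ x = a • x → m ≤ a.re) : ReLowerBound m W := by
  have hW' : W * Wᴴ = 1 := mul_eq_one_comm.mp hW
  have hH := isHermitian_re_sub m W
  refine hH.posSemidef_iff_eigenvalues_nonneg.mpr fun j => ?_
  set μ := hH.eigenvalues j with hμ
  have hv := hH.mulVec_eigenvectorBasis j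
  have hv0 : WithLp.ofLp (hH.eigenvectorBasis j) ≠ 0 := by
    have := hH.eigenvectorBasis.orthonormal.ne_zero j
    simpa using this
  set v := WithLp.ofLp (hH.eigenvectorBasis j)
  -- For an eigenvector `v` of `W + Wᴴ - 2m` with eigenvalue `μ`, unitarity gives `(W² - (2m + μ) W
  -- + 1) v = 0`. Factoring makes one root an eigenvalue of `W`; it has modulus one and the other
  -- root is its conjugate, so `2m + μ` is twice its real part.
  obtain ⟨a, ha⟩ : ∃ a : ℂ, a * a - (2 * m + μ : ℝ) * a + 1 = 0 := by
    obtain ⟨s, hs⟩ := IsAlgClosed.exists_pow_nat_eq (((2 * m + μ : ℝ) : ℂ) ^ 2 - 4) two_pos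
    exact ⟨(((2 * m + μ : ℝ) : ℂ) + s) / 2, by linear_combination hs / 4⟩
  set b : ℂ := (2 * m + μ : ℝ) - a with hb
  have hab : a * b = 1 := by rw [hb]; linear_combination -ha
  have hWv : (W - a • (1 : Matrix n n ℂ)) *ᵥ ((W - b • (1 : Matrix n n ℂ)) *ᵥ v) = 0 := by
    rw [mulVec_mulVec]
    have e : (W - a • (1 : Matrix n n ℂ)) * (W - b • (1 : Matrix n n ℂ)) =
        W * (W + Wᴴ - ((2 * m : ℝ) : ℂ) • (1 : Matrix n n ℂ)) - (μ : ℂ) • W := by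
      simp only [Matrix.mul_sub, Matrix.sub_mul, Matrix.mul_add, Matrix.mul_smul, Matrix.smul_mul,
        Matrix.mul_one, Matrix.one_mul, hW', smul_sub, smul_smul, mul_comm b a, hab]
      rw [hb]
      push_cast
      module
    rw [e, sub_mulVec, ← mulVec_mulVec, hv, smul_mulVec, mulVec_smul]
    ext i
    simp [μ]
  have key : (W - a • (1 : Matrix n n ℂ)).det = 0 ∨ (W - b • (1 : Matrix n n ℂ)).det = 0 := by
    by_cases hz : (W - b • (1 : Matrix n n ℂ)) *ᵥ v = 0
    · exact .inr (exists_mulVec_eq_zero_iff.mp ⟨v, hv0, hz⟩)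
    · exact .inl (exists_mulVec_eq_zero_iff.mp ⟨_, hz, hWv⟩)
  have conc : ∀ a b : ℂ, a * b = 1 → a + b = (2 * m + μ : ℝ) →
      (W - a • (1 : Matrix n n ℂ)).det = 0 → 0 ≤ μ := by
    intro a b hab hs hdet
    obtain ⟨x, hx, hxa⟩ := exists_eigenvector hdet
    have h1 := normSq_eigenvalue hW hx hxa
    have ha0 : a ≠ 0 := left_ne_zero_of_mul_eq_one hab
    have h2 : b = star a := mul_left_cancel₀ ha0 (hab.trans h1.symm)
    rw [h2] at hs
    have h3 := congrArg Complex.re hs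
    simp at h3
    linarith [h a x hx hxa]
  rcases key with hk | hk
  · exact conc a b hab (by rw [hb]; ring) hk
  · exact conc b a (by rw [mul_comm]; exact hab) (by rw [hb]; ring) hk

/-- A diagonal contraction can be replaced by its unitary part. -/
theorem ReLowerBound.unitary_part {U : Matrix n n ℂ} (hU : U * Uᴴ = 1) {m : ℝ} (hm : 0 < m)
    {E : n → ℂ} (hE : ∀ i, ‖E i‖ ≤ 1) (h : ReLowerBound m (U * diagonal E)) :
    ∃ e : n → ℂ, (∀ i, ‖e i‖ = 1) ∧ ReLowerBound m (U * diagonal e) := by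
  have hE0 : ∀ i, E i ≠ 0 := by
    intro i hi
    have := reLowerBound_iff.mp h (Pi.single i 1)
    rw [← mulVec_mulVec] at this
    have h0 : diagonal E *ᵥ Pi.single i 1 = 0 := by
      ext j
      rw [mulVec_diagonal]
      by_cases hj : j = i
      · subst hj; simp [hi]
      · simp [hj]
    rw [h0] at this
    simp at this
    linarith
  have hn0 : ∀ i, 0 < ‖E i‖ := fun i => norm_pos_iff.mpr (hE0 i)
  have he : ∀ i, ‖E i / ‖E i‖‖ = 1 := fun i => by
    rw [norm_div, Complex.norm_real, norm_norm, div_self (hn0 i).ne']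
  refine ⟨fun i => E i / ‖E i‖, he, ?_⟩
  refine reLowerBound_of_eigenvalues (isometry_mul_diagonal hU he) fun a x hx hxa => ?_
  -- Rescaling by `‖E i‖` makes `diagonal E` act on `z` as its unitary part acts on the eigenvector
  -- `x`; since `‖E i‖ ≤ 1`, the weighted norms compare in the right direction.
  set z : n → ℂ := fun i => x i / ‖E i‖ with hz
  have hz1 : diagonal E *ᵥ z = diagonal (fun i => E i / ‖E i‖) *ᵥ x := by
    ext i
    rw [mulVec_diagonal, mulVec_diagonal, hz]
    ring
  have h1 := reLowerBound_iff.mp h z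
  rw [← mulVec_mulVec, hz1, mulVec_mulVec, hxa, dotProduct_smul, smul_eq_mul] at h1
  have h2 : star z ⬝ᵥ x = ((∑ i, ‖x i‖ ^ 2 / ‖E i‖ : ℝ) : ℂ) := by
    rw [dotProduct, Complex.ofReal_sum]
    refine Finset.sum_congr rfl fun i _ => ?_
    rw [Pi.star_apply, hz, star_div₀, Complex.star_def, Complex.conj_ofReal,
      div_mul_eq_mul_div, Complex.conj_mul']
    push_cast
    rfl
  have h3 : (star z ⬝ᵥ z).re = ∑ i, ‖x i‖ ^ 2 / ‖E i‖ / ‖E i‖ := by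
    rw [dotProduct, Complex.re_sum]
    refine Finset.sum_congr rfl fun i _ => ?_
    rw [Pi.star_apply, hz, star_div₀, Complex.star_def, Complex.conj_ofReal,
      div_mul_div_comm, Complex.conj_mul', div_div]
    norm_cast
  rw [h2, h3, mul_comm a, Complex.re_ofReal_mul] at h1
  have h4 : ∑ i, ‖x i‖ ^ 2 / ‖E i‖ ≤ ∑ i, ‖x i‖ ^ 2 / ‖E i‖ / ‖E i‖ := by
    refine Finset.sum_le_sum fun i _ => ?_
    exact le_div_self (by positivity) (hn0 i) (hE i)
  have h5 : 0 < ∑ i, ‖x i‖ ^ 2 / ‖E i‖ := by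
    obtain ⟨j, hj⟩ := Function.ne_iff.mp hx
    have hj' : 0 < ‖x j‖ := norm_pos_iff.mpr hj
    exact Finset.sum_pos' (fun i _ => by positivity)
      ⟨j, Finset.mem_univ j, div_pos (by positivity) (hn0 j)⟩
  have h6 := (mul_le_mul_of_nonneg_left h4 hm.le).trans h1
  rw [mul_comm] at h6
  exact le_of_mul_le_mul_left h6 h5

end Spectral

/-! ### Optimal one-copy states and extremal phases. -/

section PhaseState

variable {n : Type*} [Fintype n] [DecidableEq n]

/-- `A` is a state for which the two measurements have the same statistics, with overlaps of a
common phase `z` relative to `e`. -/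
def PhaseState (U : Matrix n n ℂ) (e : n → ℂ) (z : ℂ) (A : Matrix n n ℂ) : Prop :=
  IsState A ∧ (∀ i, (A * U) i i = z * star (e i) * A i i) ∧ ∀ i, (Uᴴ * A * U) i i = A i i

theorem mul_star_eq_one {z : ℂ} (h : ‖z‖ = 1) : z * star z = 1 := by
  rw [Complex.star_def, Complex.mul_conj', h]
  simp

/-- Because `A` is Hermitian and `W = U * diagonal e` is unitary, `z` comes out on either side of
`A`; thus `Uᴴ * A * U` is `A` conjugated by a diagonal unitary. -/
theorem phaseState_of_eigen {U : Matrix n n ℂ} {e : n → ℂ} (hU : U * Uᴴ = 1)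
    (he : ∀ i, ‖e i‖ = 1) {z : ℂ} (hz : z * star z = 1) {A : Matrix n n ℂ} (hA : IsState A)
    (h : U * diagonal e * A = z • A) : PhaseState U e z A := by
  set W := U * diagonal e with hW
  have hWW := isometry_mul_diagonal hU he
  have hUW : U = W * diagonal (star e) := by
    rw [hW, Matrix.mul_assoc, diagonal_mul_diagonal]
    have : (fun i => e i * star e i) = 1 := funext fun i => mul_star_eq_one (he i)
    rw [this, Pi.one_def, diagonal_one, Matrix.mul_one]
  have h1 : Wᴴ * A = star z • A := by
    have h2 : A = z • (Wᴴ * A) := by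
      rw [← Matrix.mul_smul, ← h, ← Matrix.mul_assoc, hWW, Matrix.one_mul]
    calc Wᴴ * A = (star z * z) • (Wᴴ * A) := by rw [mul_comm, hz, one_smul]
      _ = star z • A := by rw [mul_smul, ← h2]
  have h3 : A * W = z • A := by
    have := congrArg conjTranspose h1
    rwa [conjTranspose_mul, conjTranspose_conjTranspose, conjTranspose_smul, star_star,
      hA.1.isHermitian.eq] at this
  refine ⟨hA, fun i => ?_, fun i => ?_⟩
  · rw [hUW, ← Matrix.mul_assoc, h3, mul_diagonal, Matrix.smul_apply, smul_eq_mul, Pi.star_apply]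
    ring
  · have : Uᴴ * A * U = diagonal e * A * diagonal (star e) := by
      rw [hUW, conjTranspose_mul, diagonal_conjTranspose, star_star, Matrix.mul_assoc (diagonal e),
        h1, ← Matrix.mul_assoc, Matrix.mul_smul, Matrix.smul_mul, Matrix.mul_assoc (diagonal e), h3,
        Matrix.mul_smul, smul_smul, mul_comm, hz, one_smul]
    rw [this, mul_diagonal, diagonal_mul, Pi.star_apply]
    linear_combination A i i * mul_star_eq_one (he i)

/-- An optimal state, dephased with respect to the optimal unitary, splits into two states
supported on the eigenspaces with extremal phases. -/
theorem exists_phaseStates {U R : Matrix n n ℂ} (hU : U * Uᴴ = 1) {m : ℝ} (hm : 0 < m)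
    (hR : IsState R) (hRm : ∑ i, ‖(R * U) i i‖ = m)
    (hmin : ∀ ρ : Matrix n n ℂ, IsState ρ → m ≤ ∑ i, ‖(ρ * U) i i‖) :
    ∃ (α : ℝ) (e : n → ℂ) (A B : Matrix n n ℂ), 0 ≤ α ∧ α ≤ Real.pi / 2 ∧ (∀ i, ‖e i‖ = 1) ∧
      ReLowerBound (Real.cos α) (U * diagonal e) ∧
      PhaseState U e (Complex.exp (α * Complex.I)) A ∧
      PhaseState U e (Complex.exp (-(α * Complex.I))) B ∧ ∀ i, A i i = B i i := by
  obtain ⟨E, hE, hEm⟩ := exists_contraction_of_le hm hmin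
  obtain ⟨e, he, hW⟩ := (reLowerBound_of_forall_isState hEm).unitary_part hU hm hE
  have hWW := isometry_mul_diagonal hU he
  set W := U * diagonal e with hWdef
  clear_value W
  have hWW' : W * Wᴴ = 1 := mul_eq_one_comm.mp hWW
  -- Each real part is at most `‖(R * U) i i‖`, while duality bounds the sums the other way; so
  -- equality holds termwise and the entries are nonnegative reals.
  have hRW : ∀ i, (R * W) i i = (‖(R * U) i i‖ : ℂ) := by
    have h1 : ∀ i, ((R * W) i i).re ≤ ‖(R * U) i i‖ := fun i => by
      refine (Complex.re_le_norm _).trans (le_of_eq ?_)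
      rw [hWdef, ← Matrix.mul_assoc, mul_diagonal, norm_mul, he i, mul_one]
    have h2 : ∑ i, ‖(R * U) i i‖ ≤ ∑ i, ((R * W) i i).re := by
      rw [hRm, ← Complex.re_sum]
      exact hW.re_trace_le hR
    have h3 := (Finset.sum_eq_sum_iff_of_le fun i _ => h1 i).mp
      (le_antisymm (Finset.sum_le_sum fun i _ => h1 i) h2)
    intro i
    have h4 : ((R * W) i i).re = ‖(R * W) i i‖ := by
      rw [h3 i (Finset.mem_univ i), hWdef, ← Matrix.mul_assoc, mul_diagonal, norm_mul, he i, mul_one]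
    rw [← h3 i (Finset.mem_univ i)]
    exact Complex.ext rfl (Complex.abs_re_eq_norm.mp (by rw [h4, abs_norm]))
  have htr : (R * W).trace = m := by
    rw [← hRm, Complex.ofReal_sum]
    exact Finset.sum_congr rfl fun i _ => hRW i
  have hstar : ∀ i, (Wᴴ * R) i i = star ((R * W) i i) := fun i => by
    rw [← conjTranspose_apply, conjTranspose_mul, hR.1.isHermitian.eq]
  have hstar' : ∀ i, (R * Wᴴ) i i = star ((W * R) i i) := fun i => by
    rw [← conjTranspose_apply, conjTranspose_mul, hR.1.isHermitian.eq]
  have htr' : (R * Wᴴ).trace = m := by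
    rw [Matrix.trace_mul_comm, ← conjTranspose_conjTranspose (Wᴴ * R), conjTranspose_mul,
      conjTranspose_conjTranspose, hR.1.isHermitian.eq, trace_conjTranspose, htr, Complex.star_def,
      Complex.conj_ofReal]
  -- Complementary slackness: `W + Wᴴ - 2m` and `R` are positive with trace product zero. On the
  -- range of `R` this reads `W² - 2m W + 1 = 0`, with roots `exp (± i arccos m)`.
  have hker : W * R + Wᴴ * R = (2 * m : ℂ) • R := by
    have h := mul_eq_zero_of_trace hW hR.1 (by
      rw [Matrix.trace_mul_comm, Matrix.mul_sub, Matrix.mul_add, trace_sub, trace_add, htr, htr',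
        Matrix.mul_smul, Matrix.mul_one, trace_smul, hR.2, smul_eq_mul]
      push_cast
      ring)
    rw [Matrix.sub_mul, Matrix.add_mul, Matrix.smul_mul, Matrix.one_mul, sub_eq_zero] at h
    rw [h]
    push_cast
    rfl
  have hreal : ∀ i, star ((W * R) i i) = (W * R) i i := by
    intro i
    have h1 := congrFun (congrFun hker i) i
    rw [Matrix.add_apply, Matrix.smul_apply, hstar, hRW, smul_eq_mul] at h1
    have h2 : star (R i i) = R i i := hR.1.isHermitian.apply i i
    rw [eq_sub_of_add_eq h1, star_sub, star_mul', h2]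
    simp
  have htrace : ∀ z : ℂ, ((W - z • (1 : Matrix n n ℂ)) * R * (W - z • (1 : Matrix n n ℂ))ᴴ).trace =
      1 + z * star z - (z + star z) * m := by
    intro z
    rw [Matrix.mul_assoc, Matrix.trace_mul_comm, Matrix.mul_assoc]
    have : (W - z • (1 : Matrix n n ℂ))ᴴ * (W - z • (1 : Matrix n n ℂ)) =
        (1 + z * star z) • (1 : Matrix n n ℂ) - z • Wᴴ - star z • W := by
      rw [conjTranspose_sub, conjTranspose_smul, conjTranspose_one, Matrix.sub_mul, Matrix.mul_sub,
        Matrix.mul_sub, hWW]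
      simp only [Matrix.mul_smul, Matrix.smul_mul, Matrix.mul_one, Matrix.one_mul]
      module
    rw [this, Matrix.mul_sub, Matrix.mul_sub, trace_sub, trace_sub, Matrix.mul_smul, Matrix.mul_smul,
      Matrix.mul_smul, trace_smul, trace_smul, trace_smul, htr, htr', Matrix.mul_one, hR.2]
    simp only [smul_eq_mul]
    ring
  have hm1 : m ≤ 1 := by
    have h1 := (Complex.nonneg_iff.mp (hR.1.mul_mul_conjTranspose_same
      (W - (1 : ℂ) • (1 : Matrix n n ℂ))).trace_nonneg).1
    rw [htrace] at h1
    simp at h1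
    linarith
  have hcos : Real.cos (Real.arccos m) = m := Real.cos_arccos (by linarith) hm1
  -- At `m = 1` the two phases coincide, so `R` serves as both states; the normalization `2 - 2m²`
  -- below would vanish.
  rcases hm1.eq_or_lt with rfl | hlt
  · have h1 : W * R = R := by
      have := (hR.1.mul_mul_conjTranspose_same (W - (1 : ℂ) • (1 : Matrix n n ℂ))).trace_eq_zero_iff.mp
        (by rw [htrace]; norm_num)
      have h2 := mul_mul_eq_zero_of_trace .one hR.1 (W - (1 : ℂ) • (1 : Matrix n n ℂ)) (by
        rw [Matrix.one_mul, this, trace_zero])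
      rw [Matrix.one_mul, one_smul, Matrix.sub_mul, Matrix.one_mul, sub_eq_zero] at h2
      exact h2
    have hP : PhaseState U e 1 R := phaseState_of_eigen hU he (by simp) hR (by rw [one_smul, ← hWdef, h1])
    exact ⟨0, e, R, R, le_rfl, by positivity, he, by simpa [← hWdef] using hW, by simpa using hP,
      by simpa using hP, fun _ => rfl⟩
  have hs0 : 0 < 2 - 2 * m ^ 2 := by nlinarith
  have hs0' : ((2 - 2 * m ^ 2 : ℝ) : ℂ) ≠ 0 := by exact_mod_cast hs0.ne'
  -- The factor `W - star z` annihilates the component with the conjugate phase. By `hreal`, the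
  -- diagonal of `S z` depends on `z` only through `z + star z`, hence agrees for both phases.
  let S : ℂ → Matrix n n ℂ := fun z => (2 - 2 * m ^ 2 : ℝ)⁻¹ •
    ((W - star z • (1 : Matrix n n ℂ)) * R * (W - star z • (1 : Matrix n n ℂ))ᴴ)
  have hS : ∀ z : ℂ, z * star z = 1 → z + star z = 2 * m →
      PhaseState U e z (S z) ∧ ∀ i, S z i i = (2 - 2 * m ^ 2 : ℝ)⁻¹ •
        ((W * R * Wᴴ) i i + R i i - 2 * m * (W * R) i i) := by
    intro z hz hzm
    have hstate : IsState (S z) := by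
      refine ⟨(hR.1.mul_mul_conjTranspose_same _).smul (inv_nonneg.mpr hs0.le), ?_⟩
      rw [trace_smul, htrace, star_star, mul_comm (star z), hz, add_comm (star z), hzm,
        Complex.real_smul, Complex.ofReal_inv, inv_mul_eq_div, div_eq_one_iff_eq hs0']
      push_cast
      ring
    have heig : W * ((W - star z • (1 : Matrix n n ℂ)) * R) =
        z • ((W - star z • (1 : Matrix n n ℂ)) * R) := by
      have h1 : W * R = (2 * m : ℂ) • R - Wᴴ * R := eq_sub_of_add_eq hker
      have h2 : W * (W * R) = (2 * m : ℂ) • (W * R) - R := by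
        conv_lhs => rw [h1, Matrix.mul_sub, Matrix.mul_smul, ← Matrix.mul_assoc, hWW', Matrix.one_mul]
      rw [Matrix.sub_mul, Matrix.mul_sub, h2, Matrix.smul_mul, Matrix.one_mul, Matrix.mul_smul,
        ← hzm, smul_sub, smul_smul, hz]
      module
    refine ⟨phaseState_of_eigen hU he hz hstate ?_, fun i => ?_⟩
    · rw [← hWdef]
      change W * ((2 - 2 * m ^ 2 : ℝ)⁻¹ • _) = z • ((2 - 2 * m ^ 2 : ℝ)⁻¹ • _)
      rw [Matrix.mul_smul, smul_comm, ← Matrix.mul_assoc, heig, Matrix.smul_mul]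
    · simp only [S]
      rw [Matrix.smul_apply]
      congr 1
      have : (W - star z • (1 : Matrix n n ℂ)) * R * (W - star z • (1 : Matrix n n ℂ))ᴴ =
          W * R * Wᴴ + (z * star z) • R - z • (W * R) - star z • (R * Wᴴ) := by
        rw [conjTranspose_sub, conjTranspose_smul, conjTranspose_one, star_star, Matrix.sub_mul,
          Matrix.mul_sub, Matrix.sub_mul, Matrix.sub_mul]
        simp only [Matrix.mul_smul, Matrix.smul_mul, Matrix.mul_one, Matrix.one_mul]
        module
      rw [this, hz]
      simp only [Matrix.sub_apply, Matrix.add_apply, Matrix.smul_apply, smul_eq_mul, one_mul, hstar',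
        hreal]
      linear_combination -(W * R) i i * hzm
  have hexp : ∀ z : ℂ, z = Complex.exp (Real.arccos m * Complex.I) →
      star z = Complex.exp (-(Real.arccos m * Complex.I)) ∧ z * star z = 1 ∧ z + star z = 2 * m := by
    rintro z rfl
    have h1 : star (Complex.exp (Real.arccos m * Complex.I)) =
        Complex.exp (-(Real.arccos m * Complex.I)) := by
      rw [Complex.star_def, ← Complex.exp_conj, map_mul, Complex.conj_I, Complex.conj_ofReal,
        mul_neg]
    refine ⟨h1, ?_, ?_⟩
    · rw [h1, ← Complex.exp_add, add_neg_cancel, Complex.exp_zero]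
    · rw [h1, ← neg_mul, ← Complex.two_cos, ← Complex.ofReal_cos, hcos]
  obtain ⟨h1, h2, h3⟩ := hexp _ rfl
  obtain ⟨hA, hA'⟩ := hS _ h2 h3
  obtain ⟨hB, hB'⟩ := hS (star (Complex.exp (Real.arccos m * Complex.I)))
    (by rw [star_star, mul_comm, h2]) (by rw [star_star, add_comm, h3])
  refine ⟨Real.arccos m, e, _, _, Real.arccos_nonneg m, Real.arccos_le_pi_div_two.mpr hm.le, he,
    by rwa [hcos, ← hWdef], hA, ?_, fun i => (hA' i).trans (hB' i).symm⟩
  rw [← h1]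
  exact hB

end PhaseState

/-! ### Phases reachable with tensor products and mixtures. -/

section Tensor

variable {d N : ℕ}

theorem tensorProd_mul_tensorPower_diag (A : Fin N → Matrix (Fin d) (Fin d) ℂ)
    (U : Matrix (Fin d) (Fin d) ℂ) (x : Fin N → Fin d) :
    (tensorProd A * tensorPower N U) x x = ∏ k, (A k * U) (x k) (x k) := by
  rw [tensorPower_eq, tensorProd_mul]
  rfl

theorem tensorPower_conj_diag (A : Fin N → Matrix (Fin d) (Fin d) ℂ)
    (U : Matrix (Fin d) (Fin d) ℂ) (x : Fin N → Fin d) :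
    ((tensorPower N U)ᴴ * tensorProd A * tensorPower N U) x x =
      ∏ k, (Uᴴ * A k * U) (x k) (x k) := by
  rw [tensorPower_eq, tensorProd_conjTranspose, tensorProd_mul, tensorProd_mul]
  rfl

theorem tensorPower_isometry {U : Matrix (Fin d) (Fin d) ℂ} (hU : U * Uᴴ = 1) :
    tensorPower N U * (tensorPower N U)ᴴ = 1 := by
  rw [tensorPower_eq, tensorProd_conjTranspose, tensorProd_mul, ← tensorProd_one]
  exact congrArg _ (funext fun _ => hU)

/-- The averaged phases of states of the parallel scheme that have the label distribution `w`
under both measurements. -/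
def reachablePhases (N : ℕ) (U : Matrix (Fin d) (Fin d) ℂ) (e : Fin d → ℂ)
    (w : Fin d → ℂ) : Set ℂ :=
  {r | ∃ ρ : Matrix (Fin N → Fin d) (Fin N → Fin d) ℂ, IsState ρ ∧
    (∀ x, ρ x x = ∏ k, w (x k)) ∧
    (∀ x, ((tensorPower N U)ᴴ * ρ * tensorPower N U) x x = ∏ k, w (x k)) ∧
    ∀ x, (ρ * tensorPower N U) x x = r * ∏ k, (star (e (x k)) * w (x k))}

/-- With the label distribution held fixed, every condition is affine in `ρ` and `r`. -/
theorem convex_reachablePhases (U : Matrix (Fin d) (Fin d) ℂ) (e w : Fin d → ℂ) :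
    Convex ℝ (reachablePhases N U e w) := by
  rintro r ⟨ρ, hρ, h1, h2, h3⟩ s ⟨τ, hτ, g1, g2, g3⟩ a b ha hb hab
  have habC : (a : ℂ) + b = 1 := by exact_mod_cast hab
  refine ⟨a • ρ + b • τ, convex_isState hρ hτ ha hb hab, fun x => ?_, fun x => ?_, fun x => ?_⟩
  · rw [Matrix.add_apply, Matrix.smul_apply, Matrix.smul_apply, h1, g1, Complex.real_smul,
      Complex.real_smul, ← add_mul, habC, one_mul]
  · rw [Matrix.mul_add, Matrix.add_mul, Matrix.mul_smul, Matrix.mul_smul, Matrix.smul_mul,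
      Matrix.smul_mul, Matrix.add_apply, Matrix.smul_apply, Matrix.smul_apply, h2, g2,
      Complex.real_smul, Complex.real_smul, ← add_mul, habC, one_mul]
  · rw [Matrix.add_mul, Matrix.smul_mul, Matrix.smul_mul, Matrix.add_apply, Matrix.smul_apply,
      Matrix.smul_apply, h3, g3]
    simp only [Complex.real_smul]
    ring

theorem prod_mem_reachablePhases {U : Matrix (Fin d) (Fin d) ℂ} {e w : Fin d → ℂ}
    {z : Fin N → ℂ} {A : Fin N → Matrix (Fin d) (Fin d) ℂ} (hA : ∀ k, PhaseState U e (z k) (A k))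
    (hw : ∀ k i, A k i i = w i) : ∏ k, z k ∈ reachablePhases N U e w := by
  refine ⟨tensorProd A, isState_tensorProd fun k => (hA k).1, fun x => ?_, fun x => ?_, fun x => ?_⟩
  · exact Finset.prod_congr rfl fun k _ => hw k (x k)
  · rw [tensorPower_conj_diag]
    exact Finset.prod_congr rfl fun k _ => ((hA k).2.2 (x k)).trans (hw k (x k))
  · rw [tensorProd_mul_tensorPower_diag, ← Finset.prod_mul_distrib]
    exact Finset.prod_congr rfl fun k _ => by rw [(hA k).2.1, hw, mul_assoc]

theorem prod_ite_lt (j l : ℕ) (hN : N = j + l) (a b : ℂ) :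
    ∏ k : Fin N, (if (k : ℕ) < j then a else b) = a ^ j * b ^ l := by
  subst hN
  rw [Fin.prod_univ_add]
  simp

/-- Mix equally the products with `j + l` factors `A` and `j` factors `B`, and with `j` factors `A`
and `j + l` factors `B`: `j` pairs of phases cancel, and `exp (± i l α)` average to the cosine. -/
theorem cos_mem_reachablePhases {U : Matrix (Fin d) (Fin d) ℂ} {e : Fin d → ℂ} {α : ℝ}
    {A B : Matrix (Fin d) (Fin d) ℂ}
    (hA : PhaseState U e (Complex.exp (α * Complex.I)) A)
    (hB : PhaseState U e (Complex.exp (-(α * Complex.I))) B) (hAB : ∀ i, A i i = B i i)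
    (j l : ℕ) (hN : N = 2 * j + l) :
    ((Real.cos (l * α) : ℝ) : ℂ) ∈ reachablePhases N U e fun i => A i i := by
  have h : ∀ i l', N = i + l' → Complex.exp (α * Complex.I) ^ i *
      Complex.exp (-(α * Complex.I)) ^ l' ∈ reachablePhases N U e fun i => A i i := by
    intro i l' hi
    rw [← prod_ite_lt i l' hi]
    refine prod_mem_reachablePhases (A := fun k => if (k : ℕ) < i then A else B)
      (fun k => ?_) fun k i => ?_
    · split_ifs <;> assumption
    · split_ifs
      · rfl
      · exact (hAB i).symm
  have h1 := h (j + l) j (by omega)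
  have h2 := h j (j + l) (by omega)
  have h3 := convex_reachablePhases U e (fun i => A i i) h1 h2 (a := 1 / 2) (b := 1 / 2)
    (by norm_num) (by norm_num) (by norm_num)
  convert h3 using 1
  have h4 : Complex.exp (α * Complex.I) ^ j * Complex.exp (-(α * Complex.I)) ^ j = 1 := by
    rw [← mul_pow, ← Complex.exp_add, add_neg_cancel, Complex.exp_zero, one_pow]
  have h5 : (2 : ℂ) * Complex.cos (l * α) =
      Complex.exp (α * Complex.I) ^ l + Complex.exp (-(α * Complex.I)) ^ l := by
    rw [Complex.two_cos, ← Complex.exp_nat_mul, ← Complex.exp_nat_mul]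
    congr 2 <;> ring
  simp only [Complex.real_smul, pow_add]
  push_cast
  linear_combination h5 / 2 - (Complex.exp (α * Complex.I) ^ l +
    Complex.exp (-(α * Complex.I)) ^ l) / 2 * h4

theorem exists_cos_nonpos {α : ℝ} (hα : α ≤ Real.pi / 2) :
    ∀ n : ℕ, Real.pi / 2 < n * α → ∃ j l : ℕ, n = 2 * j + l ∧ Real.cos (l * α) ≤ 0 := by
  intro n
  induction n using Nat.strong_induction_on with
  | _ n ih =>
    intro hn
    -- Removing two factors lowers the angle by `2α ≤ π`, so the descent cannot jump over the
    -- interval from `π / 2` to `3π / 2`, where the cosine is nonpositive.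
    by_cases h : n * α ≤ Real.pi + Real.pi / 2
    · exact ⟨0, n, by simp, Real.cos_nonpos_of_pi_div_two_le_of_le hn.le h⟩
    · push Not at h
      have h2 : 2 ≤ n := by
        by_contra hlt
        have : n ≤ 1 := by omega
        have hα0 : 0 < α := by
          by_contra hneg
          have := mul_nonpos_of_nonneg_of_nonpos (Nat.cast_nonneg (α := ℝ) n) (not_lt.mp hneg)
          linarith [Real.pi_pos]
        have h3 : (n : ℝ) * α ≤ 1 * α := mul_le_mul_of_nonneg_right (by exact_mod_cast this) hα0.le
        linarith [Real.pi_pos]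
      obtain ⟨k, rfl⟩ := Nat.exists_eq_add_of_le h2
      push_cast at h
      obtain ⟨j, l, hk, hl⟩ := ih k (by omega) (by linarith)
      exact ⟨j + 1, l, by omega, hl⟩

/-- A nonpositive cosine is reachable, and cancelling as many pairs as possible leaves a nonnegative
one (at most one factor, `α ≤ π / 2`); convexity gives everything between. -/
theorem zero_mem_reachablePhases {U : Matrix (Fin d) (Fin d) ℂ} {e : Fin d → ℂ} {α : ℝ}
    (hα : 0 ≤ α) (hα' : α ≤ Real.pi / 2) {A B : Matrix (Fin d) (Fin d) ℂ}
    (hA : PhaseState U e (Complex.exp (α * Complex.I)) A)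
    (hB : PhaseState U e (Complex.exp (-(α * Complex.I))) B) (hAB : ∀ i, A i i = B i i)
    (hN : Real.pi / 2 < N * α) : (0 : ℂ) ∈ reachablePhases N U e fun i => A i i := by
  have hC : Convex ℝ {r : ℝ | (r : ℂ) ∈ reachablePhases N U e fun i => A i i} :=
    (convex_reachablePhases U e fun i => A i i).linear_preimage Complex.ofRealCLM.toLinearMap
  obtain ⟨j, l, h1, h2⟩ := exists_cos_nonpos hα' N hN
  have h3 : Real.cos (l * α) ∈ {r : ℝ | (r : ℂ) ∈ reachablePhases N U e fun i => A i i} :=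
    cos_mem_reachablePhases hA hB hAB j l h1
  have h4 : Real.cos ((N % 2 : ℕ) * α) ∈
      {r : ℝ | (r : ℂ) ∈ reachablePhases N U e fun i => A i i} :=
    cos_mem_reachablePhases hA hB hAB (N / 2) (N % 2) (by omega)
  have h5 : 0 ≤ Real.cos ((N % 2 : ℕ) * α) := by
    have h6 : ((N % 2 : ℕ) : ℝ) ≤ 1 := by exact_mod_cast (by omega : N % 2 ≤ 1)
    have h7 : ((N % 2 : ℕ) : ℝ) * α ≤ 1 * α := mul_le_mul_of_nonneg_right h6 hα
    have h8 : 0 ≤ ((N % 2 : ℕ) : ℝ) * α := by positivity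
    exact Real.cos_nonneg_of_neg_pi_div_two_le_of_le (by linarith [Real.pi_pos]) (by linarith)
  have := hC.ordConnected.out h3 h4 (show (0 : ℝ) ∈ Set.Icc _ _ from ⟨h2, h5⟩)
  simpa using this

end Tensor

/-! ### Assembling the optimal values. -/

section Main

variable {d N : ℕ}

/-- A state whose overlaps do not exceed the label probabilities, and the bounds that it attains,
determine all optimal values. -/
theorem optimal_values {U : Matrix (Fin d) (Fin d) ℂ} (hU : U * Uᴴ = 1) {m : ℝ}
    {ρ : Matrix (Fin N → Fin d) (Fin N → Fin d) ℂ} (hρ : IsState ρ)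
    (hρm : ∑ i, ‖(ρ * tensorPower N U) i i‖ = m)
    (h₁ : ∀ i, ‖(ρ * tensorPower N U) i i‖ ≤ (ρ i i).re)
    (h₂ : ∀ i, ‖(ρ * tensorPower N U) i i‖ ≤ (((tensorPower N U)ᴴ * ρ * tensorPower N U) i i).re)
    (hmin : ∀ τ : Matrix (Fin N → Fin d) (Fin N → Fin d) ℂ, IsState τ →
      m ≤ ∑ i, ‖(τ * tensorPower N U) i i‖)
    (hle : ∀ p ∈ adaptiveValues N U, p ≤ 1 - m) :
    IsLeast {s : ℝ | ∃ ρ : Matrix (Fin N → Fin d) (Fin N → Fin d) ℂ, IsState ρ ∧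
        s = ∑ i, ‖(ρ * tensorPower N U) i i‖} m ∧
      IsGreatest (adaptiveValues N U) (1 - m) ∧ IsGreatest (parallelValues N U) (1 - m) := by
  have hmem : 1 - m ∈ parallelValues N U := by
    refine ⟨Fintype.card (Fin N → Fin d), ?_⟩
    rw [tensorPower_eq 1, show (fun _ => 1 : Fin N → Matrix (Fin d) (Fin d) ℂ) = 1 from rfl,
      tensorProd_one, ← hρm]
    exact exists_unambiguousValue hρ (tensorPower_isometry hU) h₁ h₂
  refine ⟨⟨⟨ρ, hρ, hρm.symm⟩, ?_⟩, ⟨parallelValues_subset U hmem, hle⟩,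
    ⟨hmem, fun p hp => hle p (parallelValues_subset U hp)⟩⟩
  rintro s ⟨τ, hτ, rfl⟩
  exact hmin τ hτ

theorem optimal_values_of_reachable {U : Matrix (Fin d) (Fin d) ℂ} (hU : U * Uᴴ = 1)
    {e w : Fin d → ℂ} (he : ∀ i, ‖e i‖ = 1) {m : ℝ} (hm0 : 0 ≤ m) (hm1 : m ≤ 1)
    (hm : (m : ℂ) ∈ reachablePhases N U e w)
    (hmin : ∀ τ : Matrix (Fin N → Fin d) (Fin N → Fin d) ℂ, IsState τ →
      m ≤ ∑ i, ‖(τ * tensorPower N U) i i‖)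
    (hle : ∀ p ∈ adaptiveValues N U, p ≤ 1 - m) :
    IsLeast {s : ℝ | ∃ ρ : Matrix (Fin N → Fin d) (Fin N → Fin d) ℂ, IsState ρ ∧
        s = ∑ i, ‖(ρ * tensorPower N U) i i‖} m ∧
      IsGreatest (adaptiveValues N U) (1 - m) ∧ IsGreatest (parallelValues N U) (1 - m) := by
  obtain ⟨ρ, hρ, h1, h2, h3⟩ := hm
  have hnn : ∀ x, 0 ≤ (ρ x x).re := fun x => re_diag_nonneg hρ.1 _
  have hn : ∀ x, ‖(ρ * tensorPower N U) x x‖ = m * (ρ x x).re := by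
    intro x
    have h4 : ‖ρ x x‖ = (ρ x x).re := by
      rw [← Complex.re_eq_norm.mpr hρ.1.diag_nonneg]
    rw [h3, norm_mul, Complex.norm_real, Real.norm_of_nonneg hm0, ← h4, h1, norm_prod, norm_prod]
    simp only [norm_mul, norm_star, he, one_mul]
  have hle' : ∀ x, ‖(ρ * tensorPower N U) x x‖ ≤ (ρ x x).re := fun x => by
    rw [hn]
    exact mul_le_of_le_one_left (hnn x) hm1
  refine optimal_values hU hρ ?_ hle' (fun x => ?_) hmin hle
  · simp only [hn]
    rw [← Finset.mul_sum, ← Complex.re_sum]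
    have : ∑ x, ρ x x = 1 := hρ.2
    rw [this, Complex.one_re, mul_one]
  · rw [h2, ← h1]
    exact hle' x

end Main

end VNDisc

theorem mainTheorem7 {d : ℕ} (hd : 0 < d) (N : ℕ) (U : Matrix.unitaryGroup (Fin d) ℂ) :
    ∃ m : ℝ,
      IsLeast {s : ℝ | ∃ ρ : Matrix (Fin N → Fin d) (Fin N → Fin d) ℂ, VNDisc.IsState ρ ∧
        s = ∑ i, ‖(ρ * VNDisc.tensorPower N (U : Matrix (Fin d) (Fin d) ℂ)) i i‖} m ∧
      IsGreatest (VNDisc.adaptiveValues N (U : Matrix (Fin d) (Fin d) ℂ)) (1 - m) ∧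
      IsGreatest (VNDisc.parallelValues N (U : Matrix (Fin d) (Fin d) ℂ)) (1 - m) := by
  open VNDisc in
  obtain ⟨U, hU⟩ := U
  replace hU : U * U.conjTranspose = 1 := Matrix.mem_unitaryGroup_iff.mp hU
  have hU' : U.conjTranspose * U = 1 := mul_eq_one_comm.mp hU
  have : Nonempty (Fin d) := ⟨⟨0, hd⟩⟩
  have hle0 : ∀ p ∈ adaptiveValues N U, p ≤ 1 - 0 := by
    rintro p ⟨a, V, hp⟩
    rw [sub_zero]
    exact adaptive_le_one V hU hp
  have hmin0 : ∀ τ : Matrix (Fin N → Fin d) (Fin N → Fin d) ℂ, IsState τ →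
      0 ≤ ∑ i, ‖(τ * tensorPower N U) i i‖ :=
    fun τ _ => Finset.sum_nonneg fun i _ => norm_nonneg _
  obtain ⟨R, hR, hmin⟩ := exists_isState_min U
  have hmnn : 0 ≤ ∑ i, ‖(R * U) i i‖ := Finset.sum_nonneg fun i _ => norm_nonneg _
  rcases Nat.eq_zero_or_pos N with rfl | hN
  -- Without queries the angle bound is `0 * α = 0`, so the trivial choice `α = π`, `e = 1` already
  -- yields `m = 1`.
  · have hW : ReLowerBound (Real.cos Real.pi) (U * Matrix.diagonal fun _ => 1) := by
      rw [Real.cos_pi, Matrix.diagonal_one, Matrix.mul_one]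
      exact reLowerBound_neg_one hU'
    have hlow := fun τ => le_sum_norm_diag (N := 0) hU (fun _ => norm_one) Real.pi_pos.le hW
      (by simpa using Real.pi_pos.le) (ρ := τ)
    have hup : ∀ p ∈ adaptiveValues 0 U, p ≤ 1 - 1 := by
      rintro p ⟨a, V, hp⟩
      simpa using adaptive_le V hU (fun _ => norm_one) Real.pi_pos.le hW
        (by simpa using Real.pi_pos.le) hp
    refine ⟨1, optimal_values_of_reachable (e := 1) (w := 1) hU (by simp) zero_le_one le_rfl ?_
      (by simpa using hlow) hup⟩
    simpa using prod_mem_reachablePhases (N := 0) (U := U) (e := 1) (w := 1) (z := Fin.elim0)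
      (A := Fin.elim0) (fun k => k.elim0) fun k => k.elim0
  -- If one copy has minimum zero, product copies of its minimizer have zero overlaps, so perfect
  -- discrimination needs no duality.
  rcases hmnn.eq_or_lt with h0 | hpos
  · have hz : ∀ i, (R * U) i i = 0 := fun i => norm_eq_zero.mp
      ((Finset.sum_eq_zero_iff_of_nonneg fun i _ => norm_nonneg _).mp h0.symm i (Finset.mem_univ i))
    have hρ : IsState (tensorProd fun _ : Fin N => R) := isState_tensorProd fun _ => hR
    have hzN : ∀ x, ((tensorProd fun _ : Fin N => R) * tensorPower N U) x x = 0 := fun x => by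
      rw [tensorProd_mul_tensorPower_diag]
      exact Finset.prod_eq_zero (Finset.mem_univ ⟨0, hN⟩) (hz _)
    refine ⟨0, optimal_values hU hρ (by simp [hzN]) (fun x => ?_) (fun x => ?_) hmin0 hle0⟩
    · rw [hzN, norm_zero]
      exact re_diag_nonneg hρ.1 _
    · rw [hzN, norm_zero]
      exact re_conj_diag_nonneg hρ.1 _ _
  obtain ⟨α, e, A, B, hα0, hα, he, hW, hA, hB, hAB⟩ := exists_phaseStates hU hpos hR rfl hmin
  -- Up to `π / 2` the cosine is nonnegative and is the optimum; beyond it perfect discrimination is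
  -- possible.
  by_cases hNα : N * α ≤ Real.pi / 2
  · have hNπ : N * α ≤ Real.pi := hNα.trans (by linarith [Real.pi_pos])
    have hN0 : 0 ≤ N * α := by positivity
    refine ⟨Real.cos (N * α), optimal_values_of_reachable hU he
      (Real.cos_nonneg_of_neg_pi_div_two_le_of_le (by linarith [Real.pi_pos]) hNα)
      (Real.cos_le_one _) (cos_mem_reachablePhases hA hB hAB 0 N (by simp))
      (fun τ hτ => le_sum_norm_diag hU he hα0 hW hNπ hτ) ?_⟩
    rintro p ⟨a, V, hp⟩
    exact adaptive_le V hU he hα0 hW hNπ hp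
  · refine ⟨0, optimal_values_of_reachable (w := fun i => A i i) hU he le_rfl zero_le_one ?_ hmin0 hle0⟩
    rw [Complex.ofReal_zero]
    exact zero_mem_reachablePhases hα0 hα hA hB hAB (not_le.mp hNα)
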